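/- Setting. Let $P$ be a probability distribution on a measurable space $\mathcal X$, let $\psi$ be a real functional on the probability distributions on $\mathcal X$, and write $\psi=\psi(P)$ for the target. For any input distribution $Q$ one can only observe independent computation runs $\hat\psi_1(Q),\hat\psi_2(Q),\ldots$, where $\hat\psi_r(Q)=\hat\psi(Q,\xi_r)$ with i.i.d. computation noises $\xi_r$ (of a law that does not depend on $Q$), and $E\hat\psi_r(Q)=\psi(Q)$. Let $\tau^2(Q)=\mathrm{Var}(\hat\psi_r(Q))$ and $\kappa_3(Q)=E|\hat\psi_r(Q)-\psi(Q)|^3$. Let $X_1,\ldots,X_n$ be i.i.d. from $P$ with empirical distribution $\hat P_n$, and let $P_n^{*1},\ldots,P_n^{*B}$ be the empirical distributions of $B$ resamples of size $n$, each drawn independently and uniformly with replacement from the data ($P_n^*$ denotes any one of them). Put $$\hat{\hat\psi}_{n,R_0}=\frac1{R_0}\sum_{r=1}^{R_0}\hat\psi_r(\hat P_n),\qquad \psi_{n,R}^{**b}=\frac1R\sum_{r=1}^{R}\hat\psi_r(P_n^{*b}),\quad b=1,\ldots,B,$$ where all $R_0+BR$ runs use independent computation noises, independent of the data and the resampling.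 Assumptions. (i) For some $\sigma>0$, $\sqrt n(\psi(\hat P_n)-\psi)\Rightarrow N(0,\sigma^2)$, and $\sqrt n(\psi(P_n^*)-\psi(\hat P_n))\Rightarrow N(0,\sigma^2)$ conditionally on the data in probability, i.e. for every $x\in\mathbb R$ the conditional probability of $\{\sqrt n(\psi(P_n^*)-\psi(\hat P_n))\le x\}$ given the data converges in probability to $P(N(0,\sigma^2)\le x)$. (ii) $0<\tau^2(P)<\infty$, $\kappa_3(P)<\infty$, and, as $n\to\infty$, $\tau^2(\hat P_n)\to\tau^2(P)$, $\kappa_3(\hat P_n)\to\kappa_3(P)$, $\tau^2(P_n^*)\to\tau^2(P)$ and $\kappa_3(P_n^*)\to\kappa_3(P)$ in probability. (iii) $R_0=R_0(n)$ and $R=R(n)$ satisfy $R_0/n\to p_0$ and $R/n\to p$ as $n\to\infty$, for some constants $0<p_0,p<1$. Interval. Let $B\ge1$ and $0<\alpha<1$ be fixed, let $\rho=\sqrt{p_0/p}$, and for $\theta\ge0$ let $F(\cdot\,;\theta,\rho)$ be the distribution function of $$\frac{\theta V_1+V_2}{\sqrt{\frac{\theta^2+\rho^2}{B}(Y+V_3^2)-2\sqrt{\frac{\theta^2+\rho^2}{B}}\,V_3V_2+V_2^2}},$$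 where $V_1,V_2,V_3\sim N(0,1)$ and $Y\sim\chi^2_{B-1}$ are independent ($Y=0$ if $B=1$). Let $$S_O^2=\frac1B\sum_{b=1}^B\bigl(\psi_{n,R}^{**b}-\hat{\hat\psi}_{n,R_0}\bigr)^2,\qquad q_{O,1-\alpha/2}=\min\Bigl\{q\in\mathbb R:\ \inf_{\theta\ge0}F(q;\theta,\rho)\ge1-\frac\alpha2\Bigr\},$$ $$\mathcal I_O=\bigl[\hat{\hat\psi}_{n,R_0}-q_{O,1-\alpha/2}S_O,\ \hat{\hat\psi}_{n,R_0}+q_{O,1-\alpha/2}S_O\bigr],\qquad S_O\ge 0.$$ Theorem (Asymptotic validity of the Cheap Bootstrap "centered at original estimate"). The minimum that defines $q_{O,1-\alpha/2}$ exists, and $$\liminf_{n\to\infty}\mathbb P_n(\psi\in\mathcal I_O)\ge1-\alpha,$$ where $\mathbb P_n$ denotes the probability with respect to the data $X_1,\ldots,X_n$ and all randomness from the resampling and computation. -/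

import Mathlib

open MeasureTheory ProbabilityTheory Filter Topology
open scoped NNReal ENNReal

namespace CheapBootstrap

noncomputable section

/-! ### Data, resampling and computation runs -/

/-- The empirical distribution `(1/n) ∑ᵢ δ_{xᵢ}` of a sample of size `n ≥ 1`. -/
def empirical {𝒳 : Type*} [MeasurableSpace 𝒳] {n : ℕ+} (x : Fin n → 𝒳) :
    ProbabilityMeasure 𝒳 :=
  ⟨(n : ℝ≥0∞)⁻¹ • ∑ i, Measure.dirac (x i), ⟨by
    rw [Measure.smul_apply, Measure.finsetSum_apply]
    simp only [measure_univ, Finset.sum_const, Finset.card_univ, Fintype.card_fin, nsmul_eq_mul,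
      mul_one, smul_eq_mul]
    exact ENNReal.inv_mul_cancel (by simp) (by simp)⟩⟩

/-- The law of the i.i.d. data `X₁, …, Xₙ ∼ P`. -/
def dataLaw {𝒳 : Type*} [MeasurableSpace 𝒳] (P : ProbabilityMeasure 𝒳) (n : ℕ+) :
    Measure (Fin n → 𝒳) :=
  Measure.pi fun _ => (P : Measure 𝒳)

instance {𝒳 : Type*} [MeasurableSpace 𝒳] (P : ProbabilityMeasure 𝒳) (n : ℕ+) :
    IsProbabilityMeasure (dataLaw P n) := by
  unfold dataLaw; infer_instance

/-- The law of the `n` indices of one resample: independent and uniform on the `n` data points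
(sampling with replacement). -/
def resampleLaw (n : ℕ+) : Measure (Fin n → Fin n) :=
  Measure.pi fun _ => uniformOn Set.univ

/-- The empirical distribution of the resample of the data `x` that has the indices `I`. -/
def resampled {𝒳 : Type*} [MeasurableSpace 𝒳] {n : ℕ+} (x : Fin n → 𝒳) (I : Fin n → Fin n) :
    ProbabilityMeasure 𝒳 :=
  empirical (x ∘ I)

/-- `τ²(Q)`, the variance of a single computation run driven by the input distribution `Q`. A run
driven by `Q` is `run Q ξ`, where the computation noise `ξ` has law `η`. -/
def runVar {𝒳 𝒰 : Type*} [MeasurableSpace 𝒳] [MeasurableSpace 𝒰]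
    (run : ProbabilityMeasure 𝒳 → 𝒰 → ℝ) (η : Measure 𝒰) (Q : ProbabilityMeasure 𝒳) : ℝ≥0∞ :=
  evariance (run Q) η

/-- `κ₃(Q) = E|ψ̂(Q) - ψ(Q)|³`, the third absolute central moment of a single run. -/
def runThirdMoment {𝒳 𝒰 : Type*} [MeasurableSpace 𝒳] [MeasurableSpace 𝒰]
    (ψ : ProbabilityMeasure 𝒳 → ℝ) (run : ProbabilityMeasure 𝒳 → 𝒰 → ℝ) (η : Measure 𝒰)
    (Q : ProbabilityMeasure 𝒳) : ℝ≥0∞ :=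
  ∫⁻ u, ENNReal.ofReal (|run Q u - ψ Q| ^ 3) ∂η

/-- The average of `R` runs driven by `Q`, with computation noises `ξ₁, …, ξ_R`. -/
def runMean {𝒳 𝒰 : Type*} [MeasurableSpace 𝒳] (run : ProbabilityMeasure 𝒳 → 𝒰 → ℝ)
    (Q : ProbabilityMeasure 𝒳) {R : ℕ} (ξ : Fin R → 𝒰) : ℝ :=
  (∑ r, run Q (ξ r)) / R

/-! ### The sample space of the whole procedure -/

/-- An outcome of the nested procedure: the data, the indices of the `B` resamples, the noises of
the `R₀` runs for the original estimate, and the noises of the `R` runs for each resample. -/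
abbrev Outcome (𝒳 𝒰 : Type*) (n : ℕ+) (B R₀ R : ℕ) : Type _ :=
  (Fin n → 𝒳) × (Fin B → Fin n → Fin n) × (Fin R₀ → 𝒰) × (Fin B → Fin R → 𝒰)

/-- The probability `ℙₙ` with respect to the data and all randomness from the resampling and the
computation. -/
def outcomeLaw {𝒳 𝒰 : Type*} [MeasurableSpace 𝒳] [MeasurableSpace 𝒰] (P : ProbabilityMeasure 𝒳)
    (η : Measure 𝒰) (n : ℕ+) (B R₀ R : ℕ) : Measure (Outcome 𝒳 𝒰 n B R₀ R) :=
  (dataLaw P n).prod ((Measure.pi fun _ => resampleLaw n).prod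
    ((Measure.pi fun _ => η).prod (Measure.pi fun _ => Measure.pi fun _ => η)))

section Estimators

variable {𝒳 𝒰 : Type*} [MeasurableSpace 𝒳] (run : ProbabilityMeasure 𝒳 → 𝒰 → ℝ)
  {n : ℕ+} {B R₀ R : ℕ} (ω : Outcome 𝒳 𝒰 n B R₀ R)

/-- The original (point) estimate: the average of `R₀` runs driven by the empirical
distribution of the data. -/
def pointEst : ℝ := runMean run (empirical ω.1) ω.2.2.1

/-- The `b`-th resample estimate: the average of `R` runs driven by the `b`-th resample
empirical distribution. -/
def resampleEst (b : Fin B) : ℝ := runMean run (resampled ω.1 (ω.2.1 b)) (ω.2.2.2 b)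

/-- `S_O`, where `S_O² = (1/B) ∑_b (resample estimate_b - original estimate)²`. -/
def SO : ℝ := √((∑ b, (resampleEst run ω b - pointEst run ω) ^ 2) / B)

end Estimators

/-! ### The critical value -/

/-- The chi-square distribution with `k` degrees of freedom, the law of the sum of the squares of
`k` independent standard normal variables (the point mass at `0` if `k = 0`). -/
def chiSq (k : ℕ) : Measure ℝ :=
  (Measure.pi fun _ : Fin k => gaussianReal 0 1).map fun z => ∑ i, z i ^ 2

/-- The law of
`(θV₁ + V₂) / √((θ² + ρ²)/B (Y + V₃²) - 2 √((θ² + ρ²)/B) V₃ V₂ + V₂²)`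
for independent `V₁, V₂, V₃ ∼ N(0,1)` and `Y ∼ χ²_{B-1}`. -/
def ratioLaw (B : ℕ) (θ ρ : ℝ) : Measure ℝ :=
  ((gaussianReal 0 1).prod ((gaussianReal 0 1).prod
    ((gaussianReal 0 1).prod (chiSq (B - 1))))).map
    fun v : ℝ × ℝ × ℝ × ℝ =>
      (θ * v.1 + v.2.1) /
        √((θ ^ 2 + ρ ^ 2) / B * (v.2.2.2 + v.2.2.1 ^ 2)
          - 2 * √((θ ^ 2 + ρ ^ 2) / B) * v.2.2.1 * v.2.1 + v.2.1 ^ 2)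

/-- `F(q; θ, ρ)`, the distribution function of `ratioLaw`. -/
def F (B : ℕ) (q θ ρ : ℝ) : ℝ := cdf (ratioLaw B θ ρ) q

/-- The set of all `q` with `inf_{θ ≥ 0} F(q; θ, ρ) ≥ 1 - α/2`. -/
def criticalSet (B : ℕ) (ρ α : ℝ) : Set ℝ :=
  {q | 1 - α / 2 ≤ ⨅ θ : ℝ≥0, F B q θ ρ}

/-- The critical value `q_{O,1-α/2}`, the least element of `criticalSet`. -/
def qO (B : ℕ) (ρ α : ℝ) : ℝ := sInf (criticalSet B ρ α)

/-- The interval `[original estimate - q S_O, original estimate + q S_O]`. -/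
def intervalO {𝒳 𝒰 : Type*} [MeasurableSpace 𝒳] (run : ProbabilityMeasure 𝒳 → 𝒰 → ℝ)
    {n : ℕ+} {B R₀ R : ℕ} (q : ℝ) (ω : Outcome 𝒳 𝒰 n B R₀ R) : Set ℝ :=
  Set.Icc (pointEst run ω - q * SO run ω) (pointEst run ω + q * SO run ω)

/-! ### The assumptions -/

/-- Convergence in probability to a constant `c`, for random elements `X n` that may live on
different probability spaces: `X n` leaves each neighbourhood of `c` with vanishing probability. -/
def TendstoInProb {Ω : ℕ+ → Type*} [∀ n, MeasurableSpace (Ω n)] {E : Type*} [TopologicalSpace E]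
    (μ : ∀ n, Measure (Ω n)) (X : ∀ n, Ω n → E) (c : E) : Prop :=
  ∀ s ∈ 𝓝 c, Tendsto (fun n => μ n {ω | X n ω ∉ s}) atTop (𝓝 0)

/-- The standard condition for bootstrap validity: `√n (ψ(P̂ₙ) - ψ(P)) ⇒ N(0, σ²)`, and
`√n (ψ(Pₙ*) - ψ(P̂ₙ)) ⇒ N(0, σ²)` conditionally on the data in probability, which means that the
conditional distribution function converges in probability at every point. -/
structure BootstrapValidity {𝒳 : Type*} [MeasurableSpace 𝒳] (ψ : ProbabilityMeasure 𝒳 → ℝ)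
    (P : ProbabilityMeasure 𝒳) (σ : ℝ≥0) : Prop where
  pos : 0 < σ
  original : TendstoInDistribution
    (fun (n : ℕ+) (x : Fin n → 𝒳) => √(n : ℝ) * (ψ (empirical x) - ψ P)) atTop
    (id : ℝ → ℝ) (dataLaw P) (gaussianReal 0 (σ ^ 2))
  resample : ∀ t : ℝ, TendstoInProb (dataLaw P)
    (fun n x => (resampleLaw n).real
      {I | √(n : ℝ) * (ψ (resampled x I) - ψ (empirical x)) ≤ t})
    (cdf (gaussianReal 0 (σ ^ 2)) t)

/-- Moment consistency of computation runs: `τ²` and `κ₃` at `P̂ₙ` and at `Pₙ*` converge in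
probability to their values at `P`, with `0 < τ²(P) < ∞` and `κ₃(P) < ∞`. -/
structure MomentConsistency {𝒳 𝒰 : Type*} [MeasurableSpace 𝒳] [MeasurableSpace 𝒰]
    (ψ : ProbabilityMeasure 𝒳 → ℝ) (run : ProbabilityMeasure 𝒳 → 𝒰 → ℝ) (η : Measure 𝒰)
    (P : ProbabilityMeasure 𝒳) : Prop where
  var_pos : 0 < runVar run η P
  var_lt_top : runVar run η P < ∞
  third_lt_top : runThirdMoment ψ run η P < ∞
  var_original : TendstoInProb (dataLaw P) (fun _ x => runVar run η (empirical x)) (runVar run η P)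
  third_original : TendstoInProb (dataLaw P)
    (fun _ x => runThirdMoment ψ run η (empirical x)) (runThirdMoment ψ run η P)
  var_resample : TendstoInProb (fun n => (dataLaw P n).prod (resampleLaw n))
    (fun _ z => runVar run η (resampled z.1 z.2)) (runVar run η P)
  third_resample : TendstoInProb (fun n => (dataLaw P n).prod (resampleLaw n))
    (fun _ z => runThirdMoment ψ run η (resampled z.1 z.2)) (runThirdMoment ψ run η P)

end

end CheapBootstrap

namespace CheapBootstrap

/-! ### Quantitative central limit theorem for averages of runs -/

/-! Scale three kinds of error by `√n`: the sampling error `ψ(P̂ₙ) - ψ(P)`, the computation error of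
the point estimate around `ψ(P̂ₙ)`, and the error of each resample estimate around `ψ(P̂ₙ)`.
Coverage is an inequality between these `B + 2` numbers, so it suffices to find their joint limit
law and then to bound the limiting probability.

Joint limit. Given the data, the point-estimate error and the `B` resample errors are independent,
so the joint characteristic function is the mean over the data of a unimodular factor (the sampling
error) times conditional characteristic functions (`charFun_map_errVec`). Each conditional factor
converges in mean to a constant: for averages of runs by a Taylor bound with third moments, which
tolerates random input distributions (`tendsto_lintegral_runCF`); for resampling because finitely
many values of a distribution function control a characteristic function
(`exists_finset_cdf_charFun`). Constants leave the integral, so the limit is Gaussian with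
independent coordinates, with variances `σ²`, `τ²/p₀` and `σ² + τ²/p` (`tendsto_law_errVec`).

Coverage. Strict coverage is an open condition, so the portmanteau theorem bounds the liminf from
below by the Gaussian probability. After division by the standard deviation `√(τ²/p₀)` this
probability depends only on `θ = σ / √(τ²/p₀)` and `ρ`, and a rotation of the resample coordinates
turns it into an event about `V₁, V₂, V₃, Y` (`map_sum_sumSq`). The infimum over `θ` makes the
critical value valid for the unknown `θ`; the symmetry of the ratio turns the one-sided level `1 -
α/2` into the two-sided level `1 - α` (`le_ratioBase_abs_num_lt`).

Critical value. The ratio has tails that are small uniformly in `θ`, since its denominator grows at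
least like `1 + θ` off an event of small probability (`criticalSet_nonempty`); right-continuity of
each distribution function then gives attainment of the minimum. -/

lemma norm_cexp_mul_I_sub_taylor_le (x : ℝ) :
    ‖Complex.exp (x * Complex.I) - (1 + x * Complex.I - x ^ 2 / 2)‖ ≤ 4 * |x| ^ 3 := by
  have hI : ‖(x : ℂ) * Complex.I‖ = |x| := by simp
  rcases le_or_gt |x| 1 with h | h
  · have := Complex.exp_bound (x := x * Complex.I) (by rw [hI]; exact h) (n := 3) (by norm_num)
    rw [hI] at this
    have e : ∑ m ∈ Finset.range 3, ((x : ℂ) * Complex.I) ^ m / m.factorial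
        = 1 + x * Complex.I - x ^ 2 / 2 := by
      simp [Finset.sum_range_succ, mul_pow, Nat.factorial]
      ring
    rw [e] at this
    refine this.trans ?_
    have h3 : 0 ≤ |x| ^ 3 := by positivity
    norm_num [Nat.factorial]
    linarith
  -- For `|x| > 1` no series is needed: the triangle bound `2 + |x| + |x|²/2` is below `4|x|³`.
  · have h1 : ‖Complex.exp (x * Complex.I)‖ = 1 := Complex.norm_exp_ofReal_mul_I x
    have h2 : ‖(1 : ℂ) + x * Complex.I - x ^ 2 / 2‖ ≤ 1 + |x| + |x| ^ 2 / 2 := by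
      refine (norm_sub_le _ _).trans ?_
      refine add_le_add ((norm_add_le _ _).trans (by simp)) (by simp)
    refine (norm_sub_le _ _).trans ?_
    rw [h1]
    nlinarith [mul_pos (sub_pos.2 h) (sub_pos.2 h), mul_pos (sub_pos.2 h) (mul_pos (sub_pos.2 h) (sub_pos.2 h))]

lemma abs_exp_neg_sub_one_sub_le {x : ℝ} (hx : 0 ≤ x) : |Real.exp (-x) - (1 - x)| ≤ x ^ 2 := by
  rcases le_or_gt x 1 with h | h
  · have := Real.abs_exp_sub_one_sub_id_le (x := -x) (by rw [abs_neg, abs_of_nonneg hx]; exact h)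
    rwa [neg_sq, show Real.exp (-x) - 1 - -x = Real.exp (-x) - (1 - x) by ring] at this
  · have h1 : Real.exp (-x) ≤ 1 := Real.exp_le_one_iff.2 (by linarith)
    have h2 := Real.exp_pos (-x)
    rw [abs_le]
    constructor <;> nlinarith

/-- Exchange the factors one at a time; in the unit disc the untouched factors do not enlarge the
error. -/
lemma norm_prod_sub_prod_le {ι : Type*} (s : Finset ι) (f g : ι → ℂ)
    (hf : ∀ i ∈ s, ‖f i‖ ≤ 1) (hg : ∀ i ∈ s, ‖g i‖ ≤ 1) :
    ‖∏ i ∈ s, f i - ∏ i ∈ s, g i‖ ≤ ∑ i ∈ s, ‖f i - g i‖ := by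
  classical
  induction s using Finset.induction_on with
  | empty => simp
  | insert a s ha ih =>
    rw [Finset.prod_insert ha, Finset.prod_insert ha, Finset.sum_insert ha]
    have e : f a * ∏ i ∈ s, f i - g a * ∏ i ∈ s, g i
        = (f a - g a) * ∏ i ∈ s, f i + g a * (∏ i ∈ s, f i - ∏ i ∈ s, g i) := by ring
    rw [e]
    have h1 : ‖∏ i ∈ s, f i‖ ≤ 1 := by
      rw [norm_prod]
      exact Finset.prod_le_one (fun _ _ => norm_nonneg _)
        fun i hi => hf i (Finset.mem_insert_of_mem hi)
    have h2 := ih (fun i hi => hf i (Finset.mem_insert_of_mem hi))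
      (fun i hi => hg i (Finset.mem_insert_of_mem hi))
    have h3 := hg a (Finset.mem_insert_self _ _)
    refine (norm_add_le _ _).trans (add_le_add ?_ ?_)
    · rw [norm_mul]
      exact mul_le_of_le_one_right (norm_nonneg _) h1
    · rw [norm_mul]
      exact (mul_le_of_le_one_left (norm_nonneg _) h3).trans h2

lemma norm_pow_sub_pow_le_mul (z w : ℂ) (hz : ‖z‖ ≤ 1) (hw : ‖w‖ ≤ 1) (n : ℕ) :
    ‖z ^ n - w ^ n‖ ≤ n * ‖z - w‖ := by
  simpa using norm_prod_sub_prod_le (Finset.range n) (fun _ => z) (fun _ => w)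
    (fun _ _ => hz) (fun _ _ => hw)

lemma norm_integral_cexp_mul_I_le_one {Ω : Type*} [MeasurableSpace Ω] (μ : Measure Ω)
    [IsProbabilityMeasure μ] (f : Ω → ℝ) : ‖∫ ω, Complex.exp (f ω * Complex.I) ∂μ‖ ≤ 1 := by
  refine (norm_integral_le_of_norm_le_const (C := 1) (ae_of_all _ fun ω => ?_)).trans (by simp)
  rw [Complex.norm_exp_ofReal_mul_I]

variable {𝒳 𝒰 : Type*} [MeasurableSpace 𝒳] [MeasurableSpace 𝒰]

/-- The Taylor bound integrated: the linear term drops out because `m` is the mean, and the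
quadratic term gives the variance. -/
lemma norm_integral_cexp_sub_le {η : Measure 𝒰} [IsProbabilityMeasure η] {Y : 𝒰 → ℝ} {m : ℝ}
    (hY : Integrable Y η) (hm : ∫ u, Y u ∂η = m) (hv : evariance Y η < ∞)
    (hk : ∫⁻ u, ENNReal.ofReal (|Y u - m| ^ 3) ∂η < ∞) (t : ℝ) :
    ‖∫ u, Complex.exp ((t * (Y u - m) : ℝ) * Complex.I) ∂η
        - (1 - t ^ 2 * (evariance Y η).toReal / 2 : ℝ)‖
      ≤ 4 * |t| ^ 3 * (∫⁻ u, ENNReal.ofReal (|Y u - m| ^ 3) ∂η).toReal := by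
  have hYm : AEStronglyMeasurable Y η := hY.1
  have hL2 : MemLp Y 2 η := (evariance_lt_top_iff_memLp hYm).1 hv
  set Z : 𝒰 → ℝ := fun u => Y u - m with hZ
  have hZ2 : MemLp Z 2 η := hL2.sub (memLp_const m)
  have hZ1 : Integrable Z η := hY.sub (integrable_const m)
  have hZsq : Integrable (fun u => Z u ^ 2) η := hZ2.integrable_sq
  have hZm : AEStronglyMeasurable Z η := hZ1.1
  have hZ3 : Integrable (fun u => |Z u| ^ 3) η := by
    refine ⟨(hZm.norm.pow 3), ?_⟩
    rw [hasFiniteIntegral_iff_norm]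
    refine lt_of_eq_of_lt (lintegral_congr fun u => ?_) hk
    rw [Real.norm_of_nonneg (by positivity)]
  have hvar : (evariance Y η).toReal = ∫ u, Z u ^ 2 ∂η := by
    have := variance_eq_integral hYm.aemeasurable
    rw [hm] at this
    exact this
  have hthird : (∫⁻ u, ENNReal.ofReal (|Y u - m| ^ 3) ∂η).toReal = ∫ u, |Z u| ^ 3 ∂η := by
    rw [integral_eq_lintegral_of_nonneg_ae (ae_of_all _ fun u => by positivity) hZ3.1]
  have hZ0 : ∫ u, Z u ∂η = 0 := by
    rw [hZ, integral_sub hY (integrable_const m), hm]; simp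
  have hexp : Integrable (fun u => Complex.exp ((t * Z u : ℝ) * Complex.I)) η := by
    refine Integrable.of_bound (C := 1) ?_ (ae_of_all _ fun u => ?_)
    · refine Continuous.comp_aestronglyMeasurable (g := fun z : ℝ => Complex.exp ((t * z : ℝ) *
        Complex.I)) (by fun_prop) hZm
    · rw [Complex.norm_exp_ofReal_mul_I]
  have hpoly : Integrable (fun u => (1 : ℂ) + (t * Z u : ℝ) * Complex.I - (t * Z u : ℝ) ^ 2 / 2) η := by
    refine ((integrable_const _).add ?_).sub ?_
    · exact ((hZ1.const_mul t).ofReal).mul_const _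
    · have := ((hZsq.const_mul (t ^ 2 / 2)).ofReal (𝕜 := ℂ))
      refine this.congr (ae_of_all _ fun u => ?_)
      change ((t ^ 2 / 2 * Z u ^ 2 : ℝ) : ℂ) = _
      push_cast
      ring
  have hint : ∫ u, ((1 : ℂ) + (t * Z u : ℝ) * Complex.I - (t * Z u : ℝ) ^ 2 / 2) ∂η
      = ((1 - t ^ 2 * (evariance Y η).toReal / 2 : ℝ) : ℂ) := by
    have e : ∀ u, ((1 : ℂ) + (t * Z u : ℝ) * Complex.I - (t * Z u : ℝ) ^ 2 / 2)
        = ((1 - t ^ 2 / 2 * Z u ^ 2 : ℝ) : ℂ) + ((t * Z u : ℝ) : ℂ) * Complex.I := by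
      intro u; push_cast; ring
    simp_rw [e]
    rw [integral_add, integral_mul_const, integral_complex_ofReal, integral_complex_ofReal,
      integral_const_mul, hZ0, integral_sub (integrable_const _) (hZsq.const_mul _),
      integral_const_mul, hvar]
    · simp; ring
    · exact ((integrable_const (1 : ℝ)).sub (hZsq.const_mul (t ^ 2 / 2))).ofReal
    · exact ((hZ1.const_mul t).ofReal).mul_const _
  rw [← hint, hthird, ← integral_sub hexp hpoly, ← integral_const_mul]
  refine norm_integral_le_of_norm_le (hZ3.const_mul _) (ae_of_all _ fun u => ?_)
  refine (norm_cexp_mul_I_sub_taylor_le (t * Z u)).trans_eq ?_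
  rw [abs_mul, mul_pow]; ring

lemma integral_cexp_runMean (η : Measure 𝒰) [IsProbabilityMeasure η]
    (run : ProbabilityMeasure 𝒳 → 𝒰 → ℝ) (Q : ProbabilityMeasure 𝒳) (m c : ℝ) {M : ℕ}
    (hM : 0 < M) :
    ∫ ξ : Fin M → 𝒰, Complex.exp ((c * (runMean run Q ξ - m) : ℝ) * Complex.I)
        ∂(Measure.pi fun _ => η)
      = (∫ u, Complex.exp ((c / M * (run Q u - m) : ℝ) * Complex.I) ∂η) ^ M := by
  have hM' : (M : ℝ) ≠ 0 := by positivity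
  have e : ∀ ξ : Fin M → 𝒰, Complex.exp ((c * (runMean run Q ξ - m) : ℝ) * Complex.I)
      = ∏ r, Complex.exp ((c / M * (run Q (ξ r) - m) : ℝ) * Complex.I) := by
    intro ξ
    rw [← Complex.exp_sum, ← Finset.sum_mul, ← Complex.ofReal_sum, ← Finset.mul_sum,
      Finset.sum_sub_distrib]
    congr 3
    simp [runMean]
    field_simp
  simp_rw [e]
  have := integral_fintype_prod_eq_pow (ι := Fin M) (μ := η)
    (fun u => Complex.exp ((c / M * (run Q u - m) : ℝ) * Complex.I))
  simpa using this

/-- Both terms are `M`-th powers of numbers in the unit disc, so their distance is at most `M` times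
that of the bases. With `t = c / M`, one factor `M * t ^ 2 = c ^ 2 / M` stays bounded in the regime
`c ~ √n`, `M ~ n`, and the rest vanishes with `t`. -/
lemma norm_integral_cexp_runMean_sub_le (η : Measure 𝒰) [IsProbabilityMeasure η]
    (ψ : ProbabilityMeasure 𝒳 → ℝ) (run : ProbabilityMeasure 𝒳 → 𝒰 → ℝ)
    (hunbiased : ∀ Q, Integrable (run Q) η ∧ ∫ u, run Q u ∂η = ψ Q)
    (Q : ProbabilityMeasure 𝒳) (c : ℝ) {M : ℕ} (hM : 0 < M)
    (hv : runVar run η Q < ∞) (hk : runThirdMoment ψ run η Q < ∞) :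
    ‖∫ ξ : Fin M → 𝒰, Complex.exp ((c * (runMean run Q ξ - ψ Q) : ℝ) * Complex.I)
        ∂(Measure.pi fun _ => η) - (Real.exp (-(c ^ 2 / M * (runVar run η Q).toReal / 2)) : ℝ)‖
      ≤ c ^ 2 / M * (4 * |c / M| * (runThirdMoment ψ run η Q).toReal
        + (c / M) ^ 2 * (runVar run η Q).toReal ^ 2 / 4) := by
  have hM' : (M : ℝ) ≠ 0 := by positivity
  rw [integral_cexp_runMean η run Q (ψ Q) c hM]
  set t := c / M with ht
  set V := (runVar run η Q).toReal with hV
  have hV0 : 0 ≤ V := ENNReal.toReal_nonneg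
  have e1 : ((Real.exp (-(c ^ 2 / M * V / 2)) : ℝ) : ℂ)
      = ((Real.exp (-(t ^ 2 * V / 2)) : ℝ) : ℂ) ^ M := by
    rw [← Complex.ofReal_pow, ← Real.exp_nat_mul]
    congr 2
    rw [ht]; field_simp
  rw [e1]
  refine (norm_pow_sub_pow_le_mul _ _ (norm_integral_cexp_mul_I_le_one _ _) ?_ M).trans ?_
  · rw [Complex.norm_real, Real.norm_of_nonneg (Real.exp_pos _).le]
    exact Real.exp_le_one_iff.2 (by simp; positivity)
  have h1 := norm_integral_cexp_sub_le (hunbiased Q).1 (hunbiased Q).2 hv hk t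
  have h2 : ‖((1 - t ^ 2 * V / 2 : ℝ) : ℂ) - ((Real.exp (-(t ^ 2 * V / 2)) : ℝ) : ℂ)‖
      ≤ (t ^ 2 * V / 2) ^ 2 := by
    rw [← Complex.ofReal_sub, Complex.norm_real, Real.norm_eq_abs, abs_sub_comm]
    exact abs_exp_neg_sub_one_sub_le (by positivity)
  have h3 := norm_sub_le_norm_sub_add_norm_sub
    (∫ u, Complex.exp ((t * (run Q u - ψ Q) : ℝ) * Complex.I) ∂η)
    ((1 - t ^ 2 * V / 2 : ℝ) : ℂ) ((Real.exp (-(t ^ 2 * V / 2)) : ℝ) : ℂ)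
  calc _ ≤ (M : ℝ) * (4 * |t| ^ 3 * (runThirdMoment ψ run η Q).toReal + (t ^ 2 * V / 2) ^ 2) := by
        gcongr
        exact h3.trans (add_le_add h1 h2)
    _ = _ := by
        have : c ^ 2 / M = M * |t| ^ 2 := by rw [sq_abs, ht]; field_simp
        rw [this, ← sq_abs t]; ring

/-- A central limit theorem for averages of runs whose input distribution varies, in terms of
characteristic functions. -/
lemma tendsto_integral_cexp_runMean {α : Type*} {l : Filter α} (η : Measure 𝒰)
    [IsProbabilityMeasure η]
    (ψ : ProbabilityMeasure 𝒳 → ℝ) (run : ProbabilityMeasure 𝒳 → 𝒰 → ℝ)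
    (hunbiased : ∀ Q, Integrable (run Q) η ∧ ∫ u, run Q u ∂η = ψ Q)
    (Q : α → ProbabilityMeasure 𝒳) (c : α → ℝ) (M : α → ℕ) {v k : ℝ≥0∞} (hv : v < ∞) (hk : k < ∞)
    {d : ℝ} (hM : Tendsto M l atTop) (hc : Tendsto (fun a => c a ^ 2 / M a) l (𝓝 d))
    (hQv : Tendsto (fun a => runVar run η (Q a)) l (𝓝 v))
    (hQk : Tendsto (fun a => runThirdMoment ψ run η (Q a)) l (𝓝 k)) :
    Tendsto (fun a => ∫ ξ : Fin (M a) → 𝒰,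
        Complex.exp ((c a * (runMean run (Q a) ξ - ψ (Q a)) : ℝ) * Complex.I)
        ∂(Measure.pi fun _ => η)) l (𝓝 ((Real.exp (-(d * v.toReal / 2)) : ℝ) : ℂ)) := by
  have hV : Tendsto (fun a => (runVar run η (Q a)).toReal) l (𝓝 v.toReal) :=
    (ENNReal.tendsto_toReal hv.ne).comp hQv
  have hK : Tendsto (fun a => (runThirdMoment ψ run η (Q a)).toReal) l (𝓝 k.toReal) :=
    (ENNReal.tendsto_toReal hk.ne).comp hQk
  have hMr : Tendsto (fun a => (M a : ℝ)) l atTop := tendsto_natCast_atTop_atTop.comp hM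
  have hsq : Tendsto (fun a => (c a / M a) ^ 2) l (𝓝 0) := by
    have := hc.div_atTop hMr
    refine this.congr fun a => ?_
    rw [div_pow, sq (M a : ℝ), div_div]
  have habs : Tendsto (fun a => |c a / M a|) l (𝓝 0) := by
    have := (Real.continuous_sqrt.tendsto 0).comp hsq
    rw [Real.sqrt_zero] at this
    exact this.congr fun a => Real.sqrt_sq_eq_abs _
  have hexp : Tendsto (fun a =>
      ((Real.exp (-(c a ^ 2 / M a * (runVar run η (Q a)).toReal / 2)) : ℝ) : ℂ)) l
      (𝓝 ((Real.exp (-(d * v.toReal / 2)) : ℝ) : ℂ)) := by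
    refine (Complex.continuous_ofReal.tendsto _).comp ((Real.continuous_exp.tendsto _).comp ?_)
    exact ((hc.mul hV).div_const 2).neg
  have hbound : Tendsto (fun a => c a ^ 2 / M a * (4 * |c a / M a| *
      (runThirdMoment ψ run η (Q a)).toReal
        + (c a / M a) ^ 2 * (runVar run η (Q a)).toReal ^ 2 / 4)) l (𝓝 0) := by
    have := hc.mul (((habs.const_mul 4).mul hK).add ((hsq.mul (hV.pow 2)).div_const 4))
    simpa using this
  refine tendsto_of_tendsto_of_dist (f₁ := fun a =>
      ((Real.exp (-(c a ^ 2 / M a * (runVar run η (Q a)).toReal / 2)) : ℝ) : ℂ)) hexp ?_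
  refine squeeze_zero' (Eventually.of_forall fun _ => dist_nonneg) ?_ hbound
  filter_upwards [hM.eventually_gt_atTop 0, hQv.eventually_lt_const hv,
    hQk.eventually_lt_const hk] with a ha hva hka
  rw [dist_comm, dist_eq_norm]
  exact norm_integral_cexp_runMean_sub_le η ψ run hunbiased (Q a) (c a) ha hva hka

end CheapBootstrap

namespace CheapBootstrap

/-! ### Distribution functions control characteristic functions -/

/-- Half-open intervals with rational ends are closed under nonempty intersection and supply
arbitrarily small neighbourhoods of each point, which is enough for weak convergence. -/
lemma tendsto_probabilityMeasure_of_tendsto_cdf {μ : ℕ → ProbabilityMeasure ℝ}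
    {ν : ProbabilityMeasure ℝ}
    (h : ∀ r : ℚ, Tendsto (fun k => cdf (μ k : Measure ℝ) r) atTop (𝓝 (cdf (ν : Measure ℝ) r))) :
    Tendsto μ atTop (𝓝 ν) := by
  have key : ∀ (ρ : ProbabilityMeasure ℝ) (a b : ℚ), a ≤ b →
      ((ρ (Set.Ioc (a : ℝ) b) : ℝ≥0) : ℝ) = cdf (ρ : Measure ℝ) b - cdf (ρ : Measure ℝ) a := by
    intro ρ a b hab
    rw [cdf_eq_real, cdf_eq_real, ← measureReal_sdiff (Set.Iic_subset_Iic.2 (by exact_mod_cast hab))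
      measurableSet_Iic, Set.Iic_sdiff_Iic]
    rfl
  refine IsPiSystem.tendsto_probabilityMeasure_of_tendsto_of_mem
    (S := {s | ∃ a b : ℚ, a ≤ b ∧ s = Set.Ioc (a : ℝ) b}) ?_ ?_ ?_ ?_
  · rintro _ ⟨a, b, hab, rfl⟩ _ ⟨c, d, hcd, rfl⟩ hne
    refine ⟨max a c, min b d, ?_, ?_⟩
    · obtain ⟨x, hx1, hx2⟩ := hne
      have h1 : ((max a c : ℚ) : ℝ) < x := by
        rw [Rat.cast_max]; exact max_lt hx1.1 hx2.1
      have h2 : x ≤ ((min b d : ℚ) : ℝ) := by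
        rw [Rat.cast_min]; exact le_min hx1.2 hx2.2
      exact_mod_cast (h1.trans_le h2).le
    · rw [Set.Ioc_inter_Ioc, Rat.cast_max, Rat.cast_min]
  · rintro _ ⟨a, b, hab, rfl⟩
    exact measurableSet_Ioc
  · intro u hu x hx
    obtain ⟨l, r, hlr, hsub⟩ := (mem_nhds_iff_exists_Ioo_subset.1 (hu.mem_nhds hx))
    obtain ⟨a, ha1, ha2⟩ := exists_rat_btwn hlr.1
    obtain ⟨b, hb1, hb2⟩ := exists_rat_btwn hlr.2
    refine ⟨_, ⟨a, b, by exact_mod_cast (ha2.trans hb1).le, rfl⟩, Ioc_mem_nhds ha2 hb1, ?_⟩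
    exact fun y hy => hsub ⟨ha1.trans hy.1, hy.2.trans_lt hb2⟩
  · rintro _ ⟨a, b, hab, rfl⟩
    rw [← NNReal.tendsto_coe, key _ _ _ hab]
    simp_rw [key _ _ _ hab]
    exact (h b).sub (h a)

/-- If a probability measure has a distribution function close to that of `ν` at finitely many
suitable points, then its characteristic function is close to that of `ν` at a given point. -/
lemma exists_finset_cdf_charFun (ν : Measure ℝ) [IsProbabilityMeasure ν] (a : ℝ) {ε : ℝ}
    (hε : 0 < ε) :
    ∃ (S : Finset ℝ) (δ : ℝ), 0 < δ ∧ ∀ (μ : Measure ℝ) [IsProbabilityMeasure μ],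
      (∀ t ∈ S, |cdf μ t - cdf ν t| < δ) → ‖charFun μ a - charFun ν a‖ < ε := by
  classical
  -- Otherwise there are measures `μ k` that agree with `ν` up to `1 / (k + 1)` at the first `k + 1`
  -- rationals but keep their characteristic functions apart at `a`; they converge weakly to `ν`, a
  -- contradiction.
  by_contra! hcon
  obtain ⟨f, hf⟩ := exists_surjective_nat ℚ
  have : ∀ k : ℕ, ∃ μ : ProbabilityMeasure ℝ,
      (∀ t ∈ (Finset.range (k + 1)).image (fun j => (f j : ℝ)),
        |cdf (μ : Measure ℝ) t - cdf ν t| < 1 / ((k : ℝ) + 1)) ∧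
      ε ≤ ‖charFun (μ : Measure ℝ) a - charFun ν a‖ := by
    intro k
    obtain ⟨μ, hμ, h1, h2⟩ := hcon ((Finset.range (k + 1)).image (fun j => (f j : ℝ)))
      (1 / ((k : ℝ) + 1)) (by positivity)
    exact ⟨⟨μ, hμ⟩, h1, h2⟩
  choose μ hμ1 hμ2 using this
  have hlim : Tendsto μ atTop (𝓝 (⟨ν, inferInstance⟩ : ProbabilityMeasure ℝ)) := by
    refine tendsto_probabilityMeasure_of_tendsto_cdf fun r => ?_
    obtain ⟨j, rfl⟩ := hf r
    rw [tendsto_iff_dist_tendsto_zero]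
    refine squeeze_zero' (Eventually.of_forall fun _ => dist_nonneg) ?_
      tendsto_one_div_add_atTop_nhds_zero_nat
    filter_upwards [eventually_ge_atTop j] with k hk
    rw [Real.dist_eq]
    refine (hμ1 k _ (Finset.mem_image_of_mem _ (Finset.mem_range.2 (by omega)))).le
  have hc := ProbabilityMeasure.tendsto_iff_tendsto_charFun.1 hlim a
  rw [tendsto_iff_dist_tendsto_zero] at hc
  obtain ⟨k, hk⟩ := (hc.eventually_lt_const hε).exists
  rw [dist_eq_norm] at hk
  exact absurd hk (not_lt.2 (hμ2 k))

/-! ### Convergence in probability -/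

section TendstoInProb

variable {Ω : ℕ+ → Type*} [∀ n, MeasurableSpace (Ω n)] {μ : ∀ n, Measure (Ω n)}

/-- Union bound over finitely many bad events. `Z` may depend on `n` beyond the `X i`, hence the `∀ᶠ
n`, which must be uniform in `ω`. -/
lemma TendstoInProb.of_finset {ι E : Type*} [TopologicalSpace E] {X : ι → ∀ n, Ω n → E}
    {c : ι → E} {G : Type*} [TopologicalSpace G] {Z : ∀ n, Ω n → G} {z : G}
    (h : ∀ s ∈ 𝓝 z, ∃ S : Finset ι, (∀ i ∈ S, TendstoInProb μ (X i) (c i)) ∧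
      ∃ t : ι → Set E, (∀ i ∈ S, t i ∈ 𝓝 (c i)) ∧
      ∀ᶠ n in atTop, ∀ ω, (∀ i ∈ S, X i n ω ∈ t i) → Z n ω ∈ s) :
    TendstoInProb μ Z z := by
  intro s hs
  obtain ⟨S, hX, t, ht, hev⟩ := h s hs
  have hsum : Tendsto (fun n => ∑ i ∈ S, μ n {ω | X i n ω ∉ t i}) atTop (𝓝 0) := by
    have := tendsto_finsetSum S fun i hi => hX i hi (t i) (ht i hi)
    simpa using this
  refine tendsto_of_tendsto_of_tendsto_of_le_of_le' tendsto_const_nhds hsum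
    (Eventually.of_forall fun _ => zero_le) ?_
  filter_upwards [hev] with n hn
  refine (measure_mono ?_).trans (measure_biUnion_finset_le S _)
  intro ω hω
  by_contra hcon
  simp only [Set.mem_iUnion, not_exists, Set.mem_ofPred_eq, not_not] at hcon
  exact hω (hn ω fun i hi => hcon i hi)

lemma TendstoInProb.of_two {E : Type*} [TopologicalSpace E] {X Y : ∀ n, Ω n → E}
    {c d : E} {G : Type*} [TopologicalSpace G] {Z : ∀ n, Ω n → G} {z : G}
    (hX : TendstoInProb μ X c) (hY : TendstoInProb μ Y d)
    (h : ∀ s ∈ 𝓝 z, ∃ t ∈ 𝓝 c, ∃ t' ∈ 𝓝 d,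
      ∀ᶠ n in atTop, ∀ ω, X n ω ∈ t → Y n ω ∈ t' → Z n ω ∈ s) :
    TendstoInProb μ Z z := by
  refine TendstoInProb.of_finset (X := fun b : Bool => cond b X Y) (c := fun b => cond b c d)
    fun s hs => ?_
  obtain ⟨t, ht, t', ht', hev⟩ := h s hs
  refine ⟨Finset.univ, ?_, fun b => cond b t t', ?_, ?_⟩
  · rintro (_ | _) -
    exacts [hY, hX]
  · rintro (_ | _) -
    exacts [ht', ht]
  · filter_upwards [hev] with n hn ω hω
    exact hn ω (hω true (Finset.mem_univ _)) (hω false (Finset.mem_univ _))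

/-- Bounded convergence: the integrand is at most `2` on an event of vanishing probability and at
most `ε / 2` elsewhere. -/
lemma TendstoInProb.tendsto_lintegral_enorm [∀ n, IsProbabilityMeasure (μ n)]
    {Z : ∀ n, Ω n → ℂ} {z : ℂ} (h : TendstoInProb μ Z z) (hZ : ∀ n ω, ‖Z n ω‖ ≤ 1)
    (hz : ‖z‖ ≤ 1) : Tendsto (fun n => ∫⁻ ω, ‖Z n ω - z‖ₑ ∂(μ n)) atTop (𝓝 0) := by
  rw [ENNReal.tendsto_nhds_zero]
  intro ε hε
  have hbad := h (Metric.eball z (ε / 2)) (Metric.eball_mem_nhds z (ENNReal.half_pos hε.ne'))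
  have hbad2 : Tendsto (fun n => 2 * μ n {ω | Z n ω ∉ Metric.eball z (ε / 2)}) atTop (𝓝 0) := by
    simpa using ENNReal.Tendsto.const_mul hbad (Or.inr (by simp : (2 : ℝ≥0∞) ≠ ∞))
  filter_upwards [(ENNReal.tendsto_nhds_zero.1 hbad2) (ε / 2) (ENNReal.half_pos hε.ne')] with n hn
  -- `Z n` need not be measurable, so the bad event is replaced by a measurable hull of the same
  -- measure.
  set T := toMeasurable (μ n) {ω | Z n ω ∉ Metric.eball z (ε / 2)} with hT
  have hTm : MeasurableSet T := measurableSet_toMeasurable _ _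
  calc ∫⁻ ω, ‖Z n ω - z‖ₑ ∂(μ n)
      ≤ ∫⁻ ω, (ε / 2 + T.indicator (fun _ => 2) ω) ∂(μ n) := by
        refine lintegral_mono fun ω => ?_
        by_cases hω : ω ∈ T
        · rw [Set.indicator_of_mem hω]
          refine le_trans ?_ le_add_self
          rw [← ofReal_norm, show (2 : ℝ≥0∞) = ENNReal.ofReal 2 by simp]
          refine ENNReal.ofReal_le_ofReal ((norm_sub_le _ _).trans ?_)
          linarith [hZ n ω]
        · rw [Set.indicator_of_notMem hω, add_zero]
          have h1 : Z n ω ∈ Metric.eball z (ε / 2) := by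
            by_contra h2
            exact hω (subset_toMeasurable _ _ h2)
          rw [Metric.mem_eball, edist_eq_enorm_sub] at h1
          exact h1.le
    _ = ε / 2 + 2 * μ n {ω | Z n ω ∉ Metric.eball z (ε / 2)} := by
        rw [lintegral_add_left measurable_const, lintegral_indicator_const hTm, hT,
          measure_toMeasurable]
        simp
    _ ≤ ε / 2 + ε / 2 := by gcongr
    _ = ε := ENNReal.add_halves ε

end TendstoInProb

end CheapBootstrap

namespace CheapBootstrap

variable {𝒳 𝒰 : Type*} [MeasurableSpace 𝒳] [MeasurableSpace 𝒰]

instance (n : ℕ+) : IsProbabilityMeasure (resampleLaw n) := by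
  have : IsProbabilityMeasure (uniformOn (Set.univ : Set (Fin n))) :=
    isProbabilityMeasure_uniformOn Set.finite_univ ⟨⟨0, n.pos⟩, Set.mem_univ _⟩
  unfold resampleLaw
  infer_instance

instance (P : ProbabilityMeasure 𝒳) (η : Measure 𝒰) [IsProbabilityMeasure η] (n : ℕ+)
    (B R₀ R : ℕ) : IsProbabilityMeasure (outcomeLaw P η n B R₀ R) := by
  unfold outcomeLaw
  infer_instance

/-! ### Measurability -/

lemma measurable_comp_index (n : ℕ+) :
    Measurable fun z : (Fin n → 𝒳) × (Fin n → Fin n) => z.1 ∘ z.2 := by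
  have h : Measurable fun z : (Fin n → 𝒳) × Fin n => z.1 z.2 :=
    measurable_from_prod_countable_left fun i => measurable_pi_apply i
  refine measurable_pi_lambda _ fun j => ?_
  exact h.comp (measurable_fst.prodMk ((measurable_pi_apply j).comp measurable_snd))

variable {ψ : ProbabilityMeasure 𝒳 → ℝ} {run : ProbabilityMeasure 𝒳 → 𝒰 → ℝ} {η : Measure 𝒰}
  [IsProbabilityMeasure η]

/-- Measurability of `ψ` is not a hypothesis: by unbiasedness `ψ` is the noise integral of a jointly
measurable run. -/
lemma measurable_functional_empirical
    (hmeas : ∀ n : ℕ+, Measurable fun z : (Fin n → 𝒳) × 𝒰 => run (empirical z.1) z.2)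
    (hunbiased : ∀ Q, Integrable (run Q) η ∧ ∫ u, run Q u ∂η = ψ Q) (n : ℕ+) :
    Measurable fun x : Fin n → 𝒳 => ψ (empirical x) := by
  have := ((hmeas n).stronglyMeasurable.integral_prod_right' (ν := η)).measurable
  simpa only [(hunbiased _).2] using this

lemma measurable_runMean_empirical
    (hmeas : ∀ n : ℕ+, Measurable fun z : (Fin n → 𝒳) × 𝒰 => run (empirical z.1) z.2)
    (n : ℕ+) (M : ℕ) :
    Measurable fun z : (Fin n → 𝒳) × (Fin M → 𝒰) => runMean run (empirical z.1) z.2 := by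
  have h : ∀ r : Fin M, Measurable fun z : (Fin n → 𝒳) × (Fin M → 𝒰) =>
      run (empirical z.1) (z.2 r) := fun r =>
    (hmeas n).comp (g := fun w : (Fin n → 𝒳) × 𝒰 => run (empirical w.1) w.2)
      (f := fun z : (Fin n → 𝒳) × (Fin M → 𝒰) => (z.1, z.2 r))
      (measurable_fst.prodMk ((measurable_pi_apply r).comp measurable_snd))
  exact (Finset.measurable_fun_sum Finset.univ fun r _ => h r).div_const (M : ℝ)

/-! ### Characteristic functions of averages of runs and of resampled functionals -/

/-- The characteristic function at `c` of the error of an average of `M` runs driven by `Q`. -/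
noncomputable def runCF (ψ : ProbabilityMeasure 𝒳 → ℝ) (run : ProbabilityMeasure 𝒳 → 𝒰 → ℝ)
    (η : Measure 𝒰) (M : ℕ) (c : ℝ) (Q : ProbabilityMeasure 𝒳) : ℂ :=
  ∫ ξ : Fin M → 𝒰, Complex.exp ((c * (runMean run Q ξ - ψ Q) : ℝ) * Complex.I)
    ∂(Measure.pi fun _ => η)

lemma norm_runCF_le_one (M : ℕ) (c : ℝ) (Q : ProbabilityMeasure 𝒳) :
    ‖runCF ψ run η M c Q‖ ≤ 1 :=
  norm_integral_cexp_mul_I_le_one _ _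

lemma measurable_runCF_empirical
    (hmeas : ∀ n : ℕ+, Measurable fun z : (Fin n → 𝒳) × 𝒰 => run (empirical z.1) z.2)
    (hunbiased : ∀ Q, Integrable (run Q) η ∧ ∫ u, run Q u ∂η = ψ Q) (n : ℕ+) (M : ℕ) (c : ℝ) :
    Measurable fun x : Fin n → 𝒳 => runCF ψ run η M c (empirical x) := by
  have h1 := measurable_runMean_empirical hmeas n M
  have h2 : Measurable fun z : (Fin n → 𝒳) × (Fin M → 𝒰) => ψ (empirical z.1) :=
    (measurable_functional_empirical hmeas hunbiased n).comp measurable_fst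
  have h3 : Measurable fun z : (Fin n → 𝒳) × (Fin M → 𝒰) => Complex.exp
      ((c * (runMean run (empirical z.1) z.2 - ψ (empirical z.1)) : ℝ) * Complex.I) :=
    Complex.measurable_exp.comp ((Complex.measurable_ofReal.comp
      ((h1.sub h2).const_mul c)).mul_const _)
  exact (h3.stronglyMeasurable.integral_prod_right' (ν := Measure.pi fun _ => η)).measurable

lemma measurable_runCF_resampled
    (hmeas : ∀ n : ℕ+, Measurable fun z : (Fin n → 𝒳) × 𝒰 => run (empirical z.1) z.2)
    (hunbiased : ∀ Q, Integrable (run Q) η ∧ ∫ u, run Q u ∂η = ψ Q) (n : ℕ+) (M : ℕ) (c : ℝ) :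
    Measurable fun z : (Fin n → 𝒳) × (Fin n → Fin n) =>
      runCF ψ run η M c (resampled z.1 z.2) :=
  (measurable_runCF_empirical hmeas hunbiased n M c).comp (measurable_comp_index n)

/-- The run errors are asymptotically normal, in the sense of mean convergence of their
characteristic functions given the input distributions. -/
lemma tendsto_lintegral_runCF {Ω : ℕ+ → Type*} [∀ n, MeasurableSpace (Ω n)]
    {μ : ∀ n, Measure (Ω n)} [∀ n, IsProbabilityMeasure (μ n)]
    (Q : ∀ n, Ω n → ProbabilityMeasure 𝒳) {v k : ℝ≥0∞} (hv : v < ∞) (hk : k < ∞)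
    (hunbiased : ∀ Q, Integrable (run Q) η ∧ ∫ u, run Q u ∂η = ψ Q)
    (hQv : TendstoInProb μ (fun n ω => runVar run η (Q n ω)) v)
    (hQk : TendstoInProb μ (fun n ω => runThirdMoment ψ run η (Q n ω)) k)
    (M : ℕ+ → ℕ) {p : ℝ} (hp : 0 < p)
    (hM : Tendsto (fun n : ℕ+ => (M n : ℝ) / n) atTop (𝓝 p)) (a : ℝ) :
    Tendsto (fun n : ℕ+ => ∫⁻ ω, ‖runCF ψ run η (M n) (a * √(n : ℝ)) (Q n ω)
      - ((Real.exp (-(a ^ 2 / p * v.toReal / 2)) : ℝ) : ℂ)‖ₑ ∂(μ n)) atTop (𝓝 0) := by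
  have hn : Tendsto (fun n : ℕ+ => (n : ℝ)) atTop atTop :=
    tendsto_natCast_atTop_atTop.comp tendsto_PNat_val_atTop_atTop
  have hMtop : Tendsto M atTop atTop := by
    have h1 : Tendsto (fun n : ℕ+ => (M n : ℝ)) atTop atTop := by
      refine (hM.pos_mul_atTop hp hn).congr fun n => ?_
      have : (n : ℝ) ≠ 0 := by exact_mod_cast n.ne_zero
      field_simp
    exact tendsto_natCast_atTop_iff.1 h1
  have hc : Tendsto (fun n : ℕ+ => (a * √(n : ℝ)) ^ 2 / M n) atTop (𝓝 (a ^ 2 / p)) := by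
    have := (hM.inv₀ hp.ne').const_mul (a ^ 2)
    rw [← div_eq_mul_inv] at this
    refine this.congr fun n => ?_
    rw [mul_pow, Real.sq_sqrt (by positivity), inv_div, mul_div_assoc]
  refine TendstoInProb.tendsto_lintegral_enorm ?_ (fun n ω => norm_runCF_le_one _ _ _) ?_
  · refine TendstoInProb.of_two hQv hQk fun s hs => ?_
    -- Along this filter of pairs `(n, Q)`, with `n → ∞` and the moments of `Q` tending to `v` and
    -- `k`, the deterministic limit theorem gives an estimate uniform over all `Q` with moments in
    -- fixed neighbourhoods. This is what convergence in probability can use.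
    set l : Filter (ℕ+ × ProbabilityMeasure 𝒳) :=
      atTop ×ˢ (comap (runVar run η) (𝓝 v) ⊓ comap (runThirdMoment ψ run η) (𝓝 k)) with hl
    have hfst : Tendsto Prod.fst l atTop := tendsto_fst
    have hsnd : Tendsto Prod.snd l
      (comap (runVar run η) (𝓝 v) ⊓ comap (runThirdMoment ψ run η) (𝓝 k)) := tendsto_snd
    have hvl : Tendsto (fun z : ℕ+ × ProbabilityMeasure 𝒳 => runVar run η z.2) l (𝓝 v) :=
      tendsto_comap.comp (f := Prod.snd) (g := runVar run η) (hsnd.mono_right inf_le_left)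
    have hkl : Tendsto (fun z : ℕ+ × ProbabilityMeasure 𝒳 => runThirdMoment ψ run η z.2) l (𝓝 k) :=
      tendsto_comap.comp (f := Prod.snd) (g := runThirdMoment ψ run η)
        (hsnd.mono_right inf_le_right)
    have := tendsto_integral_cexp_runMean (l := l) η ψ run hunbiased Prod.snd
      (fun z => a * √(z.1 : ℝ)) (fun z => M z.1) hv hk (hMtop.comp hfst) (hc.comp hfst)
      hvl hkl hs
    obtain ⟨N, hN, U, hU, hsub⟩ := mem_prod_iff.1 this
    obtain ⟨U1, hU1, U2, hU2, rfl⟩ := mem_inf_iff.1 hU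
    obtain ⟨t, ht, htU⟩ := mem_comap.1 hU1
    obtain ⟨t', ht', htU'⟩ := mem_comap.1 hU2
    refine ⟨t, ht, t', ht', ?_⟩
    filter_upwards [hN] with n hn ω h1 h2
    exact hsub (Set.mk_mem_prod hn ⟨htU h1, htU' h2⟩)
  · rw [Complex.norm_real, Real.norm_of_nonneg (Real.exp_pos _).le]
    exact Real.exp_le_one_iff.2 (by simp; positivity)

/-- Given the data, closeness of the conditional distribution function at finitely many points
already forces closeness of the characteristic function, so pointwise convergence in probability
suffices. -/
lemma tendsto_lintegral_resampleCF {P : ProbabilityMeasure 𝒳} {σ : ℝ≥0}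
    (hboot : BootstrapValidity ψ P σ) (a : ℝ) :
    Tendsto (fun n : ℕ+ => ∫⁻ x : Fin n → 𝒳, ‖∫ I, Complex.exp
      ((a * (√(n : ℝ) * (ψ (resampled x I) - ψ (empirical x))) : ℝ) * Complex.I) ∂(resampleLaw n)
        - charFun (gaussianReal 0 (σ ^ 2)) a‖ₑ ∂(dataLaw P n)) atTop (𝓝 0) := by
  refine TendstoInProb.tendsto_lintegral_enorm (μ := dataLaw P) (Z := fun n x => ∫ I, Complex.exp
      ((a * (√(n : ℝ) * (ψ (resampled x I) - ψ (empirical x))) : ℝ) * Complex.I) ∂(resampleLaw n))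
    ?_ (fun n x => norm_integral_cexp_mul_I_le_one _ _) (norm_charFun_le_one _)
  refine TendstoInProb.of_finset (X := fun t n x => (resampleLaw n).real
      {I | √(n : ℝ) * (ψ (resampled x I) - ψ (empirical x)) ≤ t})
      (c := fun t => cdf (gaussianReal 0 (σ ^ 2)) t) fun s hs => ?_
  obtain ⟨ε, hε, hball⟩ := Metric.mem_nhds_iff.1 hs
  obtain ⟨S, δ, hδ, hS⟩ := exists_finset_cdf_charFun (gaussianReal 0 (σ ^ 2)) a hε
  refine ⟨S, fun t _ => hboot.resample t, fun t => Metric.ball (cdf (gaussianReal 0 (σ ^ 2)) t) δ,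
    fun t _ => Metric.ball_mem_nhds _ hδ, Eventually.of_forall fun n x hx => hball ?_⟩
  have hm : Measurable fun I : Fin n → Fin n => √(n : ℝ) * (ψ (resampled x I) - ψ (empirical x)) :=
    measurable_of_finite _
  have : IsProbabilityMeasure ((resampleLaw n).map
      fun I => √(n : ℝ) * (ψ (resampled x I) - ψ (empirical x))) :=
    Measure.isProbabilityMeasure_map hm.aemeasurable
  have h := hS ((resampleLaw n).map
      fun I => √(n : ℝ) * (ψ (resampled x I) - ψ (empirical x))) fun t ht => by
    have := hx t ht
    rw [cdf_eq_real, map_measureReal_apply hm measurableSet_Iic]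
    rwa [Metric.mem_ball, Real.dist_eq] at this
  rw [Metric.mem_ball, dist_eq_norm]
  rw [charFun_apply_real, integral_map hm.aemeasurable (by fun_prop)] at h
  simpa only [Complex.ofReal_mul] using h

end CheapBootstrap

namespace CheapBootstrap

open scoped RealInnerProductSpace

variable {𝒳 𝒰 : Type*} [MeasurableSpace 𝒳]
  {ψ : ProbabilityMeasure 𝒳 → ℝ} {run : ProbabilityMeasure 𝒳 → 𝒰 → ℝ} {P : ProbabilityMeasure 𝒳}

/-! ### Joint asymptotic normality of the errors -/

/-- The scaled sampling error, the scaled error of the original estimate and the scaled errors of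
the resample estimates, the last two relative to the functional of the empirical distribution. -/
noncomputable def errVec (ψ : ProbabilityMeasure 𝒳 → ℝ) (run : ProbabilityMeasure 𝒳 → 𝒰 → ℝ)
    (P : ProbabilityMeasure 𝒳) {n : ℕ+} {B R₀ R : ℕ} (ω : Outcome 𝒳 𝒰 n B R₀ R) :
    EuclideanSpace ℝ (Option (Option (Fin B))) :=
  WithLp.toLp 2 fun i => i.elim (√(n : ℝ) * (ψ (empirical ω.1) - ψ P)) fun j =>
    j.elim (√(n : ℝ) * (pointEst run ω - ψ (empirical ω.1))) fun b =>
      √(n : ℝ) * (resampleEst run ω b - ψ (empirical ω.1))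

lemma inner_errVec {n : ℕ+} {B R₀ R : ℕ} (ω : Outcome 𝒳 𝒰 n B R₀ R)
    (t : EuclideanSpace ℝ (Option (Option (Fin B)))) :
    ⟪errVec ψ run P ω, t⟫ = t none * (√(n : ℝ) * (ψ (empirical ω.1) - ψ P))
      + (t (some none) * (√(n : ℝ) * (pointEst run ω - ψ (empirical ω.1)))
      + ∑ b, t (some (some b)) * (√(n : ℝ) * (resampleEst run ω b - ψ (empirical ω.1)))) := by
  simp [PiLp.inner_apply, Fintype.sum_option, errVec]

variable [MeasurableSpace 𝒰] {η : Measure 𝒰}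

section Measurability

variable [IsProbabilityMeasure η]

lemma measurable_pointEst
    (hmeas : ∀ n : ℕ+, Measurable fun z : (Fin n → 𝒳) × 𝒰 => run (empirical z.1) z.2)
    {n : ℕ+} {B R₀ R : ℕ} :
    Measurable fun ω : Outcome 𝒳 𝒰 n B R₀ R => pointEst run ω :=
  (measurable_runMean_empirical hmeas n R₀).comp
    (f := fun ω : Outcome 𝒳 𝒰 n B R₀ R => (ω.1, ω.2.2.1))
    (measurable_fst.prodMk (measurable_fst.comp (measurable_snd.comp measurable_snd)))

lemma measurable_resampleEst
    (hmeas : ∀ n : ℕ+, Measurable fun z : (Fin n → 𝒳) × 𝒰 => run (empirical z.1) z.2)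
    {n : ℕ+} {B R₀ R : ℕ} (b : Fin B) :
    Measurable fun ω : Outcome 𝒳 𝒰 n B R₀ R => resampleEst run ω b := by
  have h1 : Measurable fun ω : Outcome 𝒳 𝒰 n B R₀ R => ω.1 ∘ ω.2.1 b :=
    (measurable_comp_index n).comp (f := fun ω : Outcome 𝒳 𝒰 n B R₀ R => (ω.1, ω.2.1 b))
      (measurable_fst.prodMk ((measurable_pi_apply b).comp (measurable_fst.comp measurable_snd)))
  have h2 : Measurable fun ω : Outcome 𝒳 𝒰 n B R₀ R => ω.2.2.2 b :=
    (measurable_pi_apply b).comp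
      (measurable_snd.comp (measurable_snd.comp measurable_snd))
  exact (measurable_runMean_empirical hmeas n R).comp
    (f := fun ω : Outcome 𝒳 𝒰 n B R₀ R => (ω.1 ∘ ω.2.1 b, ω.2.2.2 b)) (h1.prodMk h2)

lemma measurable_errVec
    (hmeas : ∀ n : ℕ+, Measurable fun z : (Fin n → 𝒳) × 𝒰 => run (empirical z.1) z.2)
    (hunbiased : ∀ Q, Integrable (run Q) η ∧ ∫ u, run Q u ∂η = ψ Q)
    {n : ℕ+} {B R₀ R : ℕ} :
    Measurable fun ω : Outcome 𝒳 𝒰 n B R₀ R => errVec ψ run P ω := by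
  have h0 : Measurable fun ω : Outcome 𝒳 𝒰 n B R₀ R => ψ (empirical ω.1) :=
    (measurable_functional_empirical hmeas hunbiased n).comp measurable_fst
  refine (WithLp.measurable_toLp 2 _).comp (measurable_pi_lambda _ fun i => ?_)
  rcases i with _ | _ | b
  · exact (h0.sub_const _).const_mul _
  · exact ((measurable_pointEst hmeas).sub h0).const_mul _
  · exact ((measurable_resampleEst hmeas b).sub h0).const_mul _

end Measurability

/-- The conditional characteristic function, given the data, of the scaled error of a resample
estimate. -/
noncomputable def resampleErrCF (ψ : ProbabilityMeasure 𝒳 → ℝ)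
    (run : ProbabilityMeasure 𝒳 → 𝒰 → ℝ) (η : Measure 𝒰) (R : ℕ) (a : ℝ) {n : ℕ+}
    (x : Fin n → 𝒳) : ℂ :=
  ∫ I, Complex.exp ((a * (√(n : ℝ) * (ψ (resampled x I) - ψ (empirical x))) : ℝ) * Complex.I)
    * runCF ψ run η R (a * √(n : ℝ)) (resampled x I) ∂(resampleLaw n)

lemma norm_resampleErrCF_le_one [IsProbabilityMeasure η] (R : ℕ) (a : ℝ) {n : ℕ+}
    (x : Fin n → 𝒳) : ‖resampleErrCF ψ run η R a x‖ ≤ 1 := by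
  refine (norm_integral_le_of_norm_le_const (C := 1) (ae_of_all _ fun I => ?_)).trans (by simp)
  rw [norm_mul, Complex.norm_exp_ofReal_mul_I, one_mul]
  exact norm_runCF_le_one _ _ _

/-- Split each resample error into its resampling part and its computation part, then integrate in
turn over the noises with the indices fixed, over the indices with the data fixed, and over the
data. Independence makes the first two integrals products. -/
lemma charFun_map_errVec [IsProbabilityMeasure η]
    (hmeas : ∀ n : ℕ+, Measurable fun z : (Fin n → 𝒳) × 𝒰 => run (empirical z.1) z.2)
    (hunbiased : ∀ Q, Integrable (run Q) η ∧ ∫ u, run Q u ∂η = ψ Q)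
    (n : ℕ+) (B R₀ R : ℕ) (t : EuclideanSpace ℝ (Option (Option (Fin B)))) :
    charFun ((outcomeLaw P η n B R₀ R).map (errVec ψ run P)) t
      = ∫ x, Complex.exp ((t none * (√(n : ℝ) * (ψ (empirical x) - ψ P)) : ℝ) * Complex.I)
        * (runCF ψ run η R₀ (t (some none) * √(n : ℝ)) (empirical x)
          * ∏ b, resampleErrCF ψ run η R (t (some (some b))) x) ∂(dataLaw P n) := by
  have hm := measurable_errVec (P := P) hmeas hunbiased (B := B) (n := n) (R₀ := R₀) (R := R)
  rw [charFun_apply, integral_map hm.aemeasurable (by fun_prop)]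
  set f : Outcome 𝒳 𝒰 n B R₀ R → ℂ :=
    fun ω => Complex.exp ((⟪errVec ψ run P ω, t⟫ : ℝ) * Complex.I) with hf
  have hfm : Measurable f :=
    Complex.measurable_exp.comp ((Complex.measurable_ofReal.comp
      (Measurable.comp (g := fun v => (⟪v, t⟫ : ℝ)) (by fun_prop) hm)).mul_const _)
  have hf1 : ∀ ω, ‖f ω‖ ≤ 1 := fun ω => (Complex.norm_exp_ofReal_mul_I _).le
  have hfac : ∀ x I ξ₀ ξ, f (x, I, ξ₀, ξ) =
      Complex.exp ((t none * (√(n : ℝ) * (ψ (empirical x) - ψ P)) : ℝ) * Complex.I) *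
      (Complex.exp (((t (some none) * √(n : ℝ)) *
          (runMean run (empirical x) ξ₀ - ψ (empirical x)) : ℝ) * Complex.I)
        * ∏ b, (Complex.exp ((t (some (some b)) *
            (√(n : ℝ) * (ψ (resampled x (I b)) - ψ (empirical x))) : ℝ) * Complex.I)
          * Complex.exp (((t (some (some b)) * √(n : ℝ)) *
          (runMean run (resampled x (I b)) (ξ b) - ψ (resampled x (I b))) : ℝ) * Complex.I))) := by
    intro x I ξ₀ ξ
    simp only [hf, inner_errVec, pointEst, resampleEst, ← Complex.exp_add, ← Complex.exp_sum,
      ← add_mul, ← Finset.sum_mul, ← Complex.ofReal_add, ← Complex.ofReal_sum]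
    congr 3
    refine congrArg₂ _ rfl (congrArg₂ _ (by ring) (Finset.sum_congr rfl fun b _ => by ring))
  change ∫ ω, f ω ∂(outcomeLaw P η n B R₀ R) = _
  rw [outcomeLaw, integral_prod f (Integrable.of_bound hfm.aestronglyMeasurable 1 (ae_of_all _ hf1))]
  refine integral_congr_ae (ae_of_all _ fun x => ?_)
  dsimp only
  rw [integral_prod (fun y => f (x, y)) (Integrable.of_bound
    (hfm.comp measurable_prodMk_left).aestronglyMeasurable 1 (ae_of_all _ fun y => hf1 (x, y)))]
  have hinner : ∀ I : Fin B → Fin n → Fin n,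
      ∫ y : (Fin R₀ → 𝒰) × (Fin B → Fin R → 𝒰), f (x, I, y)
        ∂((Measure.pi fun _ => η).prod (Measure.pi fun _ => Measure.pi fun _ => η))
      = Complex.exp ((t none * (√(n : ℝ) * (ψ (empirical x) - ψ P)) : ℝ) * Complex.I)
        * (runCF ψ run η R₀ (t (some none) * √(n : ℝ)) (empirical x)
          * ∏ b, (Complex.exp ((t (some (some b)) *
            (√(n : ℝ) * (ψ (resampled x (I b)) - ψ (empirical x))) : ℝ) * Complex.I)
            * runCF ψ run η R (t (some (some b)) * √(n : ℝ)) (resampled x (I b)))) := by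
    intro I
    have e : ∀ y : (Fin R₀ → 𝒰) × (Fin B → Fin R → 𝒰), f (x, I, y) = _ := fun y => hfac x I y.1 y.2
    simp_rw [e]
    rw [integral_const_mul]
    congr 1
    refine (integral_prod_mul
      (fun ξ₀ : Fin R₀ → 𝒰 => Complex.exp (((t (some none) * √(n : ℝ)) *
          (runMean run (empirical x) ξ₀ - ψ (empirical x)) : ℝ) * Complex.I))
      (fun ξ : Fin B → Fin R → 𝒰 => ∏ b, (Complex.exp ((t (some (some b)) *
            (√(n : ℝ) * (ψ (resampled x (I b)) - ψ (empirical x))) : ℝ) * Complex.I)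
          * Complex.exp (((t (some (some b)) * √(n : ℝ)) *
          (runMean run (resampled x (I b)) (ξ b) - ψ (resampled x (I b))) : ℝ) * Complex.I)))).trans ?_
    congr 1
    refine (integral_fintype_prod_eq_prod (ι := Fin B) (E := fun _ => Fin R → 𝒰)
      (μ := fun _ => Measure.pi fun _ => η) (fun b ζ => (Complex.exp ((t (some (some b)) *
            (√(n : ℝ) * (ψ (resampled x (I b)) - ψ (empirical x))) : ℝ) * Complex.I)
          * Complex.exp (((t (some (some b)) * √(n : ℝ)) *
          (runMean run (resampled x (I b)) ζ - ψ (resampled x (I b))) : ℝ) * Complex.I)))).trans ?_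
    refine Finset.prod_congr rfl fun b _ => ?_
    rw [integral_const_mul]
    rfl
  simp_rw [hinner]
  rw [integral_const_mul, integral_const_mul]
  congr 2
  exact integral_fintype_prod_eq_prod (ι := Fin B) (E := fun _ => Fin n → Fin n)
      (μ := fun _ => resampleLaw n) (fun b J => Complex.exp ((t (some (some b)) *
            (√(n : ℝ) * (ψ (resampled x J) - ψ (empirical x))) : ℝ) * Complex.I)
            * runCF ψ run η R (t (some (some b)) * √(n : ℝ)) (resampled x J))

end CheapBootstrap

namespace CheapBootstrap

open scoped RealInnerProductSpace

/-! ### Limits of the characteristic functions of the errors -/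

section Limit

variable {𝒳 𝒰 : Type*} [MeasurableSpace 𝒳] [MeasurableSpace 𝒰]
  {ψ : ProbabilityMeasure 𝒳 → ℝ} {run : ProbabilityMeasure 𝒳 → 𝒰 → ℝ} {η : Measure 𝒰}
  {P : ProbabilityMeasure 𝒳} [IsProbabilityMeasure η]

/-- Replace the computation factor by its constant limit `K`, at a cost bounded by its mean error
because the other factor is unimodular; what remains is `K` times the conditional characteristic
function of the resampled functional. -/
lemma tendsto_lintegral_resampleErrCF
    (hmeas : ∀ n : ℕ+, Measurable fun z : (Fin n → 𝒳) × 𝒰 => run (empirical z.1) z.2)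
    (hunbiased : ∀ Q, Integrable (run Q) η ∧ ∫ u, run Q u ∂η = ψ Q)
    {σ : ℝ≥0} (hboot : BootstrapValidity ψ P σ) (hmom : MomentConsistency ψ run η P)
    {R : ℕ+ → ℕ} {p : ℝ} (hp : 0 < p)
    (hR : Tendsto (fun n : ℕ+ => (R n : ℝ) / n) atTop (𝓝 p)) (a : ℝ) :
    Tendsto (fun n : ℕ+ => ∫⁻ x, ‖resampleErrCF ψ run η (R n) a x
      - charFun (gaussianReal 0 (σ ^ 2)) a
        * ((Real.exp (-(a ^ 2 / p * (runVar run η P).toReal / 2)) : ℝ) : ℂ)‖ₑ ∂(dataLaw P n))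
      atTop (𝓝 0) := by
  set K : ℂ := ((Real.exp (-(a ^ 2 / p * (runVar run η P).toReal / 2)) : ℝ) : ℂ) with hK
  have hK1 : ‖K‖ ≤ 1 := by
    rw [hK, Complex.norm_real, Real.norm_of_nonneg (Real.exp_pos _).le]
    exact Real.exp_le_one_iff.2 (by simp; positivity)
  have h1 := tendsto_lintegral_runCF (ψ := ψ) (run := run) (η := η)
    (μ := fun n => (dataLaw P n).prod (resampleLaw n))
    (fun n z => resampled z.1 z.2) hmom.var_lt_top hmom.third_lt_top hunbiased
    hmom.var_resample hmom.third_resample R hp hR a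
  have h2 := tendsto_lintegral_resampleCF hboot a
  have h12 := h1.add h2
  rw [add_zero] at h12
  refine tendsto_of_tendsto_of_tendsto_of_le_of_le tendsto_const_nhds h12
    (fun _ => zero_le) fun n => ?_
  have hm : Measurable fun z : (Fin n → 𝒳) × (Fin n → Fin n) =>
      ‖runCF ψ run η (R n) (a * √(n : ℝ)) (resampled z.1 z.2) - K‖ₑ :=
    ((measurable_runCF_resampled hmeas hunbiased n (R n) _).sub_const K).enorm
  dsimp only
  rw [lintegral_prod _ hm.aemeasurable, ← lintegral_add_left hm.lintegral_prod_right']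
  refine lintegral_mono fun x => ?_
  set A : (Fin n → Fin n) → ℂ := fun I =>
    Complex.exp ((a * (√(n : ℝ) * (ψ (resampled x I) - ψ (empirical x))) : ℝ) * Complex.I) with hA
  have hA1 : ∀ I, ‖A I‖ = 1 := fun I => Complex.norm_exp_ofReal_mul_I _
  set W : (Fin n → Fin n) → ℂ := fun I => runCF ψ run η (R n) (a * √(n : ℝ)) (resampled x I) with hW
  have hW1 : ∀ I, ‖W I‖ ≤ 1 := fun I => norm_runCF_le_one _ _ _
  have hAi : Integrable A (resampleLaw n) :=
    Integrable.of_bound (measurable_of_finite A).aestronglyMeasurable 1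
      (ae_of_all _ fun I => (hA1 I).le)
  have hAWi : Integrable (fun I => A I * W I) (resampleLaw n) :=
    Integrable.of_bound (measurable_of_finite _).aestronglyMeasurable 1
      (ae_of_all _ fun I => by rw [norm_mul, hA1, one_mul]; exact hW1 I)
  have e : resampleErrCF ψ run η (R n) a x - charFun (gaussianReal 0 (σ ^ 2)) a * K
      = ∫ I, A I * (W I - K) ∂(resampleLaw n)
        + (∫ I, A I ∂(resampleLaw n) - charFun (gaussianReal 0 (σ ^ 2)) a) * K := by
    simp_rw [mul_sub]
    rw [integral_sub hAWi (hAi.mul_const K), integral_mul_const, resampleErrCF]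
    ring
  change ‖resampleErrCF ψ run η (R n) a x - _‖ₑ ≤ _
  rw [e]
  refine (enorm_add_le _ _).trans (add_le_add ?_ ?_)
  · refine (enorm_integral_le_lintegral_enorm _).trans (lintegral_mono fun I => ?_)
    rw [enorm_mul, show ‖A I‖ₑ = 1 by rw [← ofReal_norm, hA1, ENNReal.ofReal_one], one_mul]
  · rw [enorm_mul]
    refine mul_le_of_le_one_right zero_le ?_
    rw [← ofReal_norm]
    exact ENNReal.ofReal_le_one.2 hK1

lemma measurable_resampleErrCF
    (hmeas : ∀ n : ℕ+, Measurable fun z : (Fin n → 𝒳) × 𝒰 => run (empirical z.1) z.2)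
    (hunbiased : ∀ Q, Integrable (run Q) η ∧ ∫ u, run Q u ∂η = ψ Q) (n : ℕ+) (R : ℕ) (a : ℝ) :
    Measurable fun x : Fin n → 𝒳 => resampleErrCF ψ run η R a x := by
  have h0 := measurable_functional_empirical (ψ := ψ) hmeas hunbiased n
  have h1 : Measurable fun z : (Fin n → 𝒳) × (Fin n → Fin n) => ψ (empirical z.1) :=
    h0.comp measurable_fst
  have h2 : Measurable fun z : (Fin n → 𝒳) × (Fin n → Fin n) => ψ (resampled z.1 z.2) :=
    h0.comp (measurable_comp_index n)
  have h3 : Measurable fun z : (Fin n → 𝒳) × (Fin n → Fin n) => Complex.exp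
      ((a * (√(n : ℝ) * (ψ (resampled z.1 z.2) - ψ (empirical z.1))) : ℝ) * Complex.I)
      * runCF ψ run η R (a * √(n : ℝ)) (resampled z.1 z.2) :=
    (Complex.measurable_exp.comp ((Complex.measurable_ofReal.comp
      (((h2.sub h1).const_mul _).const_mul a)).mul_const _)).mul
      (measurable_runCF_resampled hmeas hunbiased n R _)
  exact (h3.stronglyMeasurable.integral_prod_right' (ν := resampleLaw n)).measurable

/-- All factors but the unimodular `A n` converge in mean to constants, so they can be exchanged for
these constants inside the integral. The mean of `A n` converges by the limit law of the sampling
error. -/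
lemma tendsto_charFun_errVec
    (hmeas : ∀ n : ℕ+, Measurable fun z : (Fin n → 𝒳) × 𝒰 => run (empirical z.1) z.2)
    (hunbiased : ∀ Q, Integrable (run Q) η ∧ ∫ u, run Q u ∂η = ψ Q)
    {σ : ℝ≥0} (hboot : BootstrapValidity ψ P σ) (hmom : MomentConsistency ψ run η P)
    {R₀ R : ℕ+ → ℕ} {p₀ p : ℝ} (hp₀ : 0 < p₀) (hp : 0 < p)
    (hR₀ : Tendsto (fun n : ℕ+ => (R₀ n : ℝ) / n) atTop (𝓝 p₀))
    (hR : Tendsto (fun n : ℕ+ => (R n : ℝ) / n) atTop (𝓝 p)) (B : ℕ)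
    (t : EuclideanSpace ℝ (Option (Option (Fin B)))) :
    Tendsto (fun n : ℕ+ => charFun ((outcomeLaw P η n B (R₀ n) (R n)).map (errVec ψ run P)) t)
      atTop (𝓝 (charFun (gaussianReal 0 (σ ^ 2)) (t none) *
        (((Real.exp (-(t (some none) ^ 2 / p₀ * (runVar run η P).toReal / 2)) : ℝ) : ℂ)
          * ∏ b, (charFun (gaussianReal 0 (σ ^ 2)) (t (some (some b))) * ((Real.exp
            (-(t (some (some b)) ^ 2 / p * (runVar run η P).toReal / 2)) : ℝ) : ℂ))))) := by
  set K₀ : ℂ := ((Real.exp (-(t (some none) ^ 2 / p₀ * (runVar run η P).toReal / 2)) : ℝ) : ℂ)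
    with hK₀
  set K : Fin B → ℂ := fun b => charFun (gaussianReal 0 (σ ^ 2)) (t (some (some b))) * ((Real.exp
            (-(t (some (some b)) ^ 2 / p * (runVar run η P).toReal / 2)) : ℝ) : ℂ) with hK
  have hexp : ∀ {x : ℝ}, 0 ≤ x → ‖((Real.exp (-x) : ℝ) : ℂ)‖ ≤ 1 := by
    intro x hx
    rw [Complex.norm_real, Real.norm_of_nonneg (Real.exp_pos _).le]
    exact Real.exp_le_one_iff.2 (by linarith)
  have hK₀1 : ‖K₀‖ ≤ 1 := hexp (by positivity)
  have hK1 : ∀ b, ‖K b‖ ≤ 1 := fun b => by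
    rw [hK, norm_mul]
    exact mul_le_one₀ (norm_charFun_le_one _) (norm_nonneg _) (hexp (by positivity))
  set A : ∀ n : ℕ+, (Fin n → 𝒳) → ℂ := fun n x =>
    Complex.exp ((t none * (√(n : ℝ) * (ψ (empirical x) - ψ P)) : ℝ) * Complex.I) with hA
  have hA1 : ∀ n x, ‖A n x‖ = 1 := fun n x => Complex.norm_exp_ofReal_mul_I _
  have hT : Tendsto (fun n : ℕ+ => ∫ x, A n x ∂(dataLaw P n)) atTop
      (𝓝 (charFun (gaussianReal 0 (σ ^ 2)) (t none))) := by
    have h' := (ProbabilityMeasure.tendsto_iff_forall_integral_rclike_tendsto ℂ).1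
      hboot.original.tendsto (BoundedContinuousFunction.innerProbChar (t none))
    simp only [ProbabilityMeasure.coe_mk, ← charFun_eq_integral_innerProbChar, Measure.map_id] at h'
    refine h'.congr fun n => ?_
    rw [charFun_apply_real, integral_map (hboot.original.forall_aemeasurable n) (by fun_prop)]
    simp only [hA, Complex.ofReal_mul]
  have hAm : ∀ n, Measurable (A n) := fun n =>
    Complex.measurable_exp.comp ((Complex.measurable_ofReal.comp
      ((((measurable_functional_empirical hmeas hunbiased n).sub_const _).const_mul _).const_mul
        _)).mul_const _)
  set w₀ : ∀ n : ℕ+, (Fin n → 𝒳) → ℂ := fun n x =>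
    runCF ψ run η (R₀ n) (t (some none) * √(n : ℝ)) (empirical x) with hw₀
  have hw₀m : ∀ n, Measurable (w₀ n) := fun n => measurable_runCF_empirical hmeas hunbiased n _ _
  set g : ∀ n : ℕ+, Fin B → (Fin n → 𝒳) → ℂ := fun n b x =>
    resampleErrCF ψ run η (R n) (t (some (some b))) x with hg
  have hgm : ∀ n b, Measurable (g n b) := fun n b => measurable_resampleErrCF hmeas hunbiased n _ _
  have hw₀1 : ∀ n x, ‖w₀ n x‖ ≤ 1 := fun n x => norm_runCF_le_one _ _ _
  have hg1 : ∀ n b x, ‖g n b x‖ ≤ 1 := fun n b x => norm_resampleErrCF_le_one _ _ _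
  have hprod : ∀ (f : Fin B → ℂ), (∀ b, ‖f b‖ ≤ 1) → ‖∏ b, f b‖ ≤ 1 := fun f hf => by
    rw [norm_prod]
    exact Finset.prod_le_one (fun _ _ => norm_nonneg _) fun b _ => hf b
  have hL1 : Tendsto (fun n : ℕ+ => ∫⁻ x, (‖w₀ n x - K₀‖ₑ + ∑ b, ‖g n b x - K b‖ₑ) ∂(dataLaw P n))
      atTop (𝓝 0) := by
    have h0 := tendsto_lintegral_runCF (ψ := ψ) (run := run) (η := η) (μ := dataLaw P)
      (fun n x => empirical x) hmom.var_lt_top hmom.third_lt_top hunbiased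
      hmom.var_original hmom.third_original R₀ hp₀ hR₀ (t (some none))
    have hb := tendsto_finsetSum Finset.univ fun (b : Fin B) _ =>
      tendsto_lintegral_resampleErrCF hmeas hunbiased hboot hmom hp hR (t (some (some b)))
    have := h0.add hb
    simp only [Finset.sum_const_zero, add_zero] at this
    refine this.congr fun n => ?_
    rw [lintegral_add_left ((hw₀m n).sub_const _).enorm, lintegral_finsetSum]
    exact fun b _ => ((hgm n b).sub_const _).enorm
  have hdiff : Tendsto (fun n : ℕ+ =>
      charFun ((outcomeLaw P η n B (R₀ n) (R n)).map (errVec ψ run P)) t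
        - (∫ x, A n x ∂(dataLaw P n)) * (K₀ * ∏ b, K b)) atTop (𝓝 0) := by
    rw [tendsto_zero_iff_enorm_tendsto_zero]
    refine tendsto_of_tendsto_of_tendsto_of_le_of_le tendsto_const_nhds hL1
      (fun _ => zero_le) fun n => ?_
    dsimp only
    rw [charFun_map_errVec hmeas hunbiased, ← integral_mul_const, ← integral_sub]
    · refine (enorm_integral_le_lintegral_enorm _).trans (lintegral_mono fun x => ?_)
      change ‖A n x * (w₀ n x * ∏ b, g n b x) - A n x * (K₀ * ∏ b, K b)‖ₑ ≤ _
      rw [← mul_sub, enorm_mul, show ‖A n x‖ₑ = 1 by rw [← ofReal_norm, hA1, ENNReal.ofReal_one],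
        one_mul, show w₀ n x * ∏ b, g n b x - K₀ * ∏ b, K b
          = (w₀ n x - K₀) * ∏ b, g n b x + K₀ * (∏ b, g n b x - ∏ b, K b) by ring]
      refine (enorm_add_le _ _).trans (add_le_add ?_ ?_)
      · rw [enorm_mul]
        refine mul_le_of_le_one_right zero_le ?_
        rw [← ofReal_norm]
        exact ENNReal.ofReal_le_one.2 (hprod _ fun b => hg1 n b x)
      · rw [enorm_mul]
        refine (mul_le_of_le_one_left zero_le ?_).trans ?_
        · rw [← ofReal_norm]
          exact ENNReal.ofReal_le_one.2 hK₀1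
        · simp only [← ofReal_norm]
          rw [← ENNReal.ofReal_sum_of_nonneg fun _ _ => norm_nonneg _]
          exact ENNReal.ofReal_le_ofReal
            (norm_prod_sub_prod_le _ _ _ (fun b _ => hg1 n b x) fun b _ => hK1 b)
    · refine Integrable.of_bound (((hAm n).mul ((hw₀m n).mul
        (Finset.measurable_fun_prod Finset.univ fun b _ => hgm n b))).aestronglyMeasurable) 1
        (ae_of_all _ fun x => ?_)
      rw [norm_mul, norm_mul]
      refine mul_le_one₀ (hA1 n x).le (by positivity) ?_
      exact mul_le_one₀ (hw₀1 n x) (norm_nonneg _) (hprod _ fun b => hg1 n b x)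
    · exact (Integrable.of_bound (hAm n).aestronglyMeasurable 1
        (ae_of_all _ fun x => (hA1 n x).le)).mul_const _
  have := hdiff.add (hT.mul_const (K₀ * ∏ b, K b))
  simpa only [sub_add_cancel, zero_add] using this

end Limit

/-! ### The limiting Gaussian law -/

/-- The law of independent standard normal variables `V₁`, `V₂`, `U₁, …, U_B`. -/
noncomputable def normalLaw (B : ℕ) : Measure (ℝ × ℝ × (Fin B → ℝ)) :=
  (gaussianReal 0 1).prod ((gaussianReal 0 1).prod (Measure.pi fun _ => gaussianReal 0 1))

instance (B : ℕ) : IsProbabilityMeasure (normalLaw B) := by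
  unfold normalLaw; infer_instance

/-- The vector of the `c V₁`, `s V₂` and `k U_b`. -/
noncomputable def scaleVec (B : ℕ) (c s k : ℝ) (z : ℝ × ℝ × (Fin B → ℝ)) :
    EuclideanSpace ℝ (Option (Option (Fin B))) :=
  WithLp.toLp 2 fun i => i.elim (c * z.1) fun j => j.elim (s * z.2.1) fun b => k * z.2.2 b

lemma measurable_scaleVec (B : ℕ) (c s k : ℝ) : Measurable (scaleVec B c s k) := by
  refine (WithLp.measurable_toLp 2 _).comp (measurable_pi_lambda _ fun i => ?_)
  rcases i with _ | _ | b
  · exact measurable_fst.const_mul c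
  · exact (measurable_fst.comp measurable_snd).const_mul s
  · have h : Measurable fun z : ℝ × ℝ × (Fin B → ℝ) => z.2.2 b :=
      (measurable_pi_apply b).comp (measurable_snd.comp measurable_snd)
    exact h.const_mul k

lemma integral_cexp_mul_gaussianReal (a : ℝ) :
    ∫ z, Complex.exp ((a * z : ℝ) * Complex.I) ∂(gaussianReal 0 1)
      = ((Real.exp (-(a ^ 2 / 2)) : ℝ) : ℂ) := by
  have := charFun_gaussianReal (μ := 0) (v := 1) a
  rw [charFun_apply_real] at this
  simp only [Complex.ofReal_mul]
  rw [this]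
  simp

lemma charFun_map_scaleVec (B : ℕ) (c s k : ℝ)
    (t : EuclideanSpace ℝ (Option (Option (Fin B)))) :
    charFun ((normalLaw B).map (scaleVec B c s k)) t
      = ((Real.exp (-((t none * c) ^ 2 / 2)) : ℝ) : ℂ)
        * (((Real.exp (-((t (some none) * s) ^ 2 / 2)) : ℝ) : ℂ)
          * ∏ b, ((Real.exp (-((t (some (some b)) * k) ^ 2 / 2)) : ℝ) : ℂ)) := by
  rw [charFun_apply, integral_map (measurable_scaleVec B c s k).aemeasurable (by fun_prop)]
  have e : ∀ z : ℝ × ℝ × (Fin B → ℝ), Complex.exp ((⟪scaleVec B c s k z, t⟫ : ℝ) * Complex.I)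
      = Complex.exp ((t none * c * z.1 : ℝ) * Complex.I)
        * (Complex.exp ((t (some none) * s * z.2.1 : ℝ) * Complex.I)
        * ∏ b, Complex.exp ((t (some (some b)) * k * z.2.2 b : ℝ) * Complex.I)) := by
    intro z
    simp only [← Complex.exp_add, ← Complex.exp_sum, ← add_mul, ← Finset.sum_mul,
      ← Complex.ofReal_add, ← Complex.ofReal_sum]
    congr 3
    simp [PiLp.inner_apply, Fintype.sum_option, scaleVec, mul_assoc]
  simp_rw [e]
  rw [normalLaw]
  refine (integral_prod_mul (fun z : ℝ => Complex.exp ((t none * c * z : ℝ) * Complex.I))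
    (fun z : ℝ × (Fin B → ℝ) => Complex.exp ((t (some none) * s * z.1 : ℝ) * Complex.I)
        * ∏ b, Complex.exp ((t (some (some b)) * k * z.2 b : ℝ) * Complex.I))).trans ?_
  rw [integral_cexp_mul_gaussianReal]
  congr 1
  refine (integral_prod_mul (fun z : ℝ => Complex.exp ((t (some none) * s * z : ℝ) * Complex.I))
    (fun z : Fin B → ℝ =>
      ∏ b, Complex.exp ((t (some (some b)) * k * z b : ℝ) * Complex.I))).trans ?_
  rw [integral_cexp_mul_gaussianReal]
  congr 1
  refine (integral_fintype_prod_eq_prod (ι := Fin B) (E := fun _ => ℝ)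
    (μ := fun _ => gaussianReal 0 1)
    (fun b z => Complex.exp ((t (some (some b)) * k * z : ℝ) * Complex.I))).trans ?_
  exact Finset.prod_congr rfl fun b _ => integral_cexp_mul_gaussianReal _

/-- The errors of the estimates are jointly asymptotically normal. -/
theorem tendsto_law_errVec {𝒳 𝒰 : Type*} [MeasurableSpace 𝒳] [MeasurableSpace 𝒰]
    {ψ : ProbabilityMeasure 𝒳 → ℝ} {run : ProbabilityMeasure 𝒳 → 𝒰 → ℝ} {η : Measure 𝒰}
    {P : ProbabilityMeasure 𝒳} [IsProbabilityMeasure η]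
    (hmeas : ∀ n : ℕ+, Measurable fun z : (Fin n → 𝒳) × 𝒰 => run (empirical z.1) z.2)
    (hunbiased : ∀ Q, Integrable (run Q) η ∧ ∫ u, run Q u ∂η = ψ Q)
    {σ : ℝ≥0} (hboot : BootstrapValidity ψ P σ) (hmom : MomentConsistency ψ run η P)
    {R₀ R : ℕ+ → ℕ} {p₀ p : ℝ} (hp₀ : 0 < p₀) (hp : 0 < p)
    (hR₀ : Tendsto (fun n : ℕ+ => (R₀ n : ℝ) / n) atTop (𝓝 p₀))
    (hR : Tendsto (fun n : ℕ+ => (R n : ℝ) / n) atTop (𝓝 p)) (B : ℕ) :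
    Tendsto (β := ProbabilityMeasure (EuclideanSpace ℝ (Option (Option (Fin B)))))
      (fun n : ℕ+ => ⟨(outcomeLaw P η n B (R₀ n) (R n)).map (errVec ψ run P),
        Measure.isProbabilityMeasure_map (measurable_errVec hmeas hunbiased).aemeasurable⟩) atTop
      (𝓝 ⟨(normalLaw B).map (scaleVec B σ √((runVar run η P).toReal / p₀)
          √(σ ^ 2 + (runVar run η P).toReal / p)),
        Measure.isProbabilityMeasure_map (measurable_scaleVec _ _ _ _).aemeasurable⟩) := by
  -- The continuity theorem is applied along a sequence indexed by `ℕ`, so `ℕ+` is reindexed.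
  have hmap : (atTop : Filter ℕ+) = map Nat.succPNat atTop := by
    rw [← OrderIso.pnatIsoNat_symm_apply, OrderIso.map_atTop]
  have hsucc : Tendsto Nat.succPNat atTop atTop := hmap.symm.le
  rw [hmap]
  refine tendsto_map'_iff.2 ?_
  refine ProbabilityMeasure.tendsto_of_tendsto_charFun fun t => ?_
  have h := (tendsto_charFun_errVec hmeas hunbiased hboot hmom hp₀ hp hR₀ hR B t).comp hsucc
  refine (h.congr fun n => rfl).trans_eq ?_
  rw [ProbabilityMeasure.coe_mk, charFun_map_scaleVec]
  have hv : 0 ≤ (runVar run η P).toReal := ENNReal.toReal_nonneg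
  have hG : ∀ a : ℝ, charFun (gaussianReal 0 (σ ^ 2)) a
      = ((Real.exp (-((a * σ) ^ 2 / 2)) : ℝ) : ℂ) := by
    intro a
    rw [charFun_gaussianReal]
    push_cast
    congr 1
    ring
  congr 1
  simp_rw [hG]
  congr 2
  · rw [mul_pow, Real.sq_sqrt (by positivity)]
    congr 4
    ring
  · refine Finset.prod_congr rfl fun b _ => ?_
    rw [← Complex.ofReal_mul, ← Real.exp_add, mul_pow _ (√_), Real.sq_sqrt (by positivity)]
    congr 2
    ring

end CheapBootstrap

namespace CheapBootstrap

/-! ### The law of the limiting ratio -/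

instance (k : ℕ) : IsProbabilityMeasure (chiSq k) := by
  unfold chiSq
  exact Measure.isProbabilityMeasure_map
    (Measurable.aemeasurable (by fun_prop))

lemma ae_nonneg_chiSq (k : ℕ) : ∀ᵐ y ∂(chiSq k), 0 ≤ y := by
  rw [chiSq, ae_map_iff (Measurable.aemeasurable (by fun_prop)) measurableSet_Ici]
  exact ae_of_all _ fun z => Finset.sum_nonneg fun i _ => sq_nonneg _

/-- The joint law of the independent variables `V₁`, `V₂`, `V₃` and `Y`. -/
noncomputable def ratioBase (B : ℕ) : Measure (ℝ × ℝ × ℝ × ℝ) :=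
  (gaussianReal 0 1).prod ((gaussianReal 0 1).prod ((gaussianReal 0 1).prod (chiSq (B - 1))))

instance (B : ℕ) : IsProbabilityMeasure (ratioBase B) := by
  unfold ratioBase; infer_instance

/-- The square of the denominator of the limiting ratio. -/
noncomputable def denSq (B : ℕ) (θ ρ : ℝ) (v : ℝ × ℝ × ℝ × ℝ) : ℝ :=
  (θ ^ 2 + ρ ^ 2) / B * (v.2.2.2 + v.2.2.1 ^ 2)
    - 2 * √((θ ^ 2 + ρ ^ 2) / B) * v.2.2.1 * v.2.1 + v.2.1 ^ 2

/-- The limiting ratio. -/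
noncomputable def ratio (B : ℕ) (θ ρ : ℝ) (v : ℝ × ℝ × ℝ × ℝ) : ℝ :=
  (θ * v.1 + v.2.1) / √(denSq B θ ρ v)

lemma measurable_denSq (B : ℕ) (θ ρ : ℝ) : Measurable (denSq B θ ρ) := by
  unfold denSq; fun_prop

lemma measurable_ratio (B : ℕ) (θ ρ : ℝ) : Measurable (ratio B θ ρ) := by
  have := measurable_denSq B θ ρ
  unfold ratio
  fun_prop

lemma ratioLaw_eq_map (B : ℕ) (θ ρ : ℝ) : ratioLaw B θ ρ = (ratioBase B).map (ratio B θ ρ) := rfl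

instance (B : ℕ) (θ ρ : ℝ) : IsProbabilityMeasure (ratioLaw B θ ρ) := by
  rw [ratioLaw_eq_map]
  exact Measure.isProbabilityMeasure_map (measurable_ratio B θ ρ).aemeasurable

/-- Completing the square shows that the radicand is nonnegative when `Y ≥ 0`. -/
lemma denSq_eq (B : ℕ) (θ ρ : ℝ) (v : ℝ × ℝ × ℝ × ℝ) :
    denSq B θ ρ v = (θ ^ 2 + ρ ^ 2) / B * v.2.2.2
      + (√((θ ^ 2 + ρ ^ 2) / B) * v.2.2.1 - v.2.1) ^ 2 := by
  have h : √((θ ^ 2 + ρ ^ 2) / B) ^ 2 = (θ ^ 2 + ρ ^ 2) / B := Real.sq_sqrt (by positivity)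
  rw [denSq, sub_sq, mul_pow, h]
  ring

lemma sq_le_denSq (B : ℕ) (θ ρ : ℝ) {v : ℝ × ℝ × ℝ × ℝ} (hv : 0 ≤ v.2.2.2) :
    (√((θ ^ 2 + ρ ^ 2) / B) * v.2.2.1 - v.2.1) ^ 2 ≤ denSq B θ ρ v := by
  rw [denSq_eq]
  have : 0 ≤ (θ ^ 2 + ρ ^ 2) / B * v.2.2.2 := by positivity
  linarith

lemma ae_ratioBase_nonneg (B : ℕ) : ∀ᵐ v ∂(ratioBase B), 0 ≤ v.2.2.2 := by
  have h1 := (Measure.quasiMeasurePreserving_snd (μ := gaussianReal 0 1)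
    (ν := chiSq (B - 1))).ae (ae_nonneg_chiSq (B - 1))
  have h2 := (Measure.quasiMeasurePreserving_snd (μ := gaussianReal 0 1)
    (ν := (gaussianReal 0 1).prod (chiSq (B - 1)))).ae h1
  exact (Measure.quasiMeasurePreserving_snd (μ := gaussianReal 0 1)).ae h2

/-- By Fubini: for fixed second coordinate the exceptional set is a single point. -/
lemma ae_prod_fst_ne {β : Type*} [MeasurableSpace β] {μ : Measure ℝ} [SFinite μ] [NullSingletonClass μ]
    {ν : Measure β} [SFinite ν] {f : β → ℝ} (hf : Measurable f) :
    ∀ᵐ z ∂(μ.prod ν), z.1 ≠ f z.2 := by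
  have hm : MeasurableSet {z : ℝ × β | z.1 = f z.2} :=
    measurableSet_eq_fun measurable_fst (hf.comp measurable_snd)
  rw [ae_iff]
  simp only [not_not]
  rw [Measure.prod_apply_symm hm]
  refine (lintegral_congr fun y => ?_).trans lintegral_zero
  exact measure_singleton (f y)

lemma ae_denSq_pos (B : ℕ) (θ ρ : ℝ) : ∀ᵐ v ∂(ratioBase B), 0 < denSq B θ ρ v := by
  have h1 : ∀ᵐ z ∂((gaussianReal 0 1).prod ((gaussianReal 0 1).prod (chiSq (B - 1)))),
      z.1 ≠ √((θ ^ 2 + ρ ^ 2) / B) * z.2.1 := by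
    have : NullSingletonClass (gaussianReal 0 1) := nullSingletonClass_gaussianReal one_ne_zero
    exact ae_prod_fst_ne (f := fun y : ℝ × ℝ => √((θ ^ 2 + ρ ^ 2) / B) * y.1)
      (measurable_fst.const_mul _)
  have h2 : ∀ᵐ v ∂(ratioBase B), v.2.1 ≠ √((θ ^ 2 + ρ ^ 2) / B) * v.2.2.1 :=
    (Measure.quasiMeasurePreserving_snd (μ := gaussianReal 0 1)).ae h1
  filter_upwards [h2, ae_ratioBase_nonneg B] with v hv hv0
  refine lt_of_lt_of_le ?_ (sq_le_denSq B θ ρ hv0)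
  exact sq_pos_of_ne_zero fun h => hv (by linarith)

/-- `denSq` does not involve `V₁`, so for `θ ≠ 0` equality determines `V₁` from the other variables.
This makes the boundary of the coverage event null. -/
lemma ae_num_ne (B : ℕ) {θ : ℝ} (hθ : θ ≠ 0) (ρ q : ℝ) :
    ∀ᵐ v ∂(ratioBase B), θ * v.1 + v.2.1 ≠ q * √(denSq B θ ρ v) := by
  have : NullSingletonClass (gaussianReal 0 1) := nullSingletonClass_gaussianReal one_ne_zero
  have hd : Measurable fun y : ℝ × ℝ × ℝ => (q * √(denSq B θ ρ (0, y)) - y.1) / θ := by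
    have := (measurable_denSq B θ ρ).comp (measurable_prodMk_left (x := (0 : ℝ)))
    exact ((this.sqrt.const_mul q).sub measurable_fst).div_const θ
  have h := ae_prod_fst_ne (μ := gaussianReal 0 1)
    (ν := (gaussianReal 0 1).prod ((gaussianReal 0 1).prod (chiSq (B - 1)))) hd
  filter_upwards [h] with v hv heq
  refine hv ?_
  rw [eq_div_iff hθ]
  have : denSq B θ ρ (0, v.2) = denSq B θ ρ v := rfl
  rw [this]
  linarith

/-- The reflection of the three normal variables. -/
def reflect (v : ℝ × ℝ × ℝ × ℝ) : ℝ × ℝ × ℝ × ℝ := (-v.1, -v.2.1, -v.2.2.1, v.2.2.2)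

lemma measurePreserving_reflect (B : ℕ) :
    MeasurePreserving reflect (ratioBase B) (ratioBase B) := by
  have h : MeasurePreserving (fun x : ℝ => -x) (gaussianReal 0 1) (gaussianReal 0 1) :=
    ⟨measurable_neg, by rw [gaussianReal_map_neg, neg_zero]⟩
  exact h.prod (h.prod (h.prod (MeasurePreserving.id (chiSq (B - 1)))))

lemma ratio_reflect (B : ℕ) (θ ρ : ℝ) (v : ℝ × ℝ × ℝ × ℝ) :
    ratio B θ ρ (reflect v) = -ratio B θ ρ v := by
  have : denSq B θ ρ (reflect v) = denSq B θ ρ v := by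
    simp only [denSq, reflect]; ring
  rw [ratio, this, ratio, ← neg_div]
  congr 1
  simp only [reflect]; ring

lemma mem_criticalSet_iff {B : ℕ} {ρ α q : ℝ} :
    q ∈ criticalSet B ρ α ↔ ∀ θ : ℝ≥0, 1 - α / 2 ≤ F B q θ ρ := by
  have hb : BddBelow (Set.range fun θ : ℝ≥0 => F B q θ ρ) :=
    ⟨0, by rintro _ ⟨θ, rfl⟩; exact cdf_nonneg _ _⟩
  exact le_ciInf_iff hb

lemma measure_ratio_gt (B : ℕ) (θ ρ q : ℝ) :
    (ratioBase B).real {v | q < ratio B θ ρ v} = 1 - F B q θ ρ := by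
  have hm : MeasurableSet {v | ratio B θ ρ v ≤ q} := measurable_ratio B θ ρ measurableSet_Iic
  have : {v | q < ratio B θ ρ v} = {v | ratio B θ ρ v ≤ q}ᶜ := by ext; simp
  rw [this, probReal_compl_eq_one_sub hm, F, cdf_eq_real, ratioLaw_eq_map,
    map_measureReal_apply (measurable_ratio B θ ρ) measurableSet_Iic]
  rfl

/-- The upper tail has probability at most `α / 2`, and reflection carries it to the lower tail. The
inequality can be strict since the boundary is null; strictness is what makes the event open later.
-/
lemma le_ratioBase_abs_num_lt {B : ℕ} {ρ α q : ℝ} (hq : q ∈ criticalSet B ρ α)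
    {θ : ℝ≥0} (hθ : θ ≠ 0) :
    1 - α ≤ (ratioBase B).real {v | |θ * v.1 + v.2.1| < q * √(denSq B θ ρ v)} := by
  have hF := mem_criticalSet_iff.1 hq θ
  have hm := measurable_ratio B θ ρ
  have h1 : (ratioBase B).real {v | q < ratio B θ ρ v} ≤ α / 2 := by
    rw [measure_ratio_gt]; linarith
  have h2 : (ratioBase B).real {v | ratio B θ ρ v < -q} ≤ α / 2 := by
    refine le_trans (le_of_eq ?_) h1
    have hs : MeasurableSet {v | q < ratio B θ ρ v} := hm measurableSet_Ioi
    have := (measurePreserving_reflect B).measure_preimage hs.nullMeasurableSet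
    rw [measureReal_def, measureReal_def, ← this]
    congr 2
    ext v
    simp only [Set.mem_preimage, Set.mem_ofPred_eq, ratio_reflect]
    exact lt_neg
  set G := {v | |(θ : ℝ) * v.1 + v.2.1| < q * √(denSq B θ ρ v)} with hG
  have hθ' : (θ : ℝ) ≠ 0 := by exact_mod_cast hθ
  have hae : ∀ᵐ v ∂(ratioBase B), v ∈ (Set.univ : Set (ℝ × ℝ × ℝ × ℝ)) →
      v ∈ G ∪ ({v | q < ratio B θ ρ v} ∪ {v | ratio B θ ρ v < -q}) := by
    filter_upwards [ae_denSq_pos B θ ρ, ae_num_ne B hθ' ρ q, ae_num_ne B hθ' ρ (-q)]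
      with v h0 hne1 hne2 _
    have hS : 0 < √(denSq B θ ρ v) := Real.sqrt_pos.2 h0
    simp only [Set.mem_union, hG, Set.mem_ofPred_eq, ratio, lt_div_iff₀ hS, div_lt_iff₀ hS]
    by_contra! hcon
    obtain ⟨hc1, hc2, hc3⟩ := hcon
    have h3 := lt_of_le_of_ne hc2 hne1
    have h4 := lt_of_le_of_ne hc3 hne2.symm
    exact absurd (abs_lt.2 ⟨by linarith, h3⟩) (not_lt.2 hc1)
  have hle : (ratioBase B).real Set.univ ≤ (ratioBase B).real
      (G ∪ ({v | q < ratio B θ ρ v} ∪ {v | ratio B θ ρ v < -q})) :=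
    ENNReal.toReal_mono (measure_ne_top _ _) (measure_mono_ae hae)
  rw [probReal_univ] at hle
  have h3 := measureReal_union_le (μ := ratioBase B) G
    ({v | q < ratio B θ ρ v} ∪ {v | ratio B θ ρ v < -q})
  have h4 := measureReal_union_le (μ := ratioBase B) {v | q < ratio B θ ρ v}
    {v | ratio B θ ρ v < -q}
  linarith

/-! ### Existence of the critical value -/

lemma gaussianReal_ball_le (m r : ℝ) :
    gaussianReal 0 1 (Metric.ball m r) ≤ ENNReal.ofReal (2 * r) := by
  have hpdf : ∀ x, gaussianPDF 0 1 x ≤ 1 := fun x => by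
    rw [gaussianPDF, ENNReal.ofReal_le_one, gaussianPDFReal]
    have h1 : (1 : ℝ) ≤ √(2 * Real.pi * (1 : ℝ≥0)) := by
      rw [Real.one_le_sqrt]
      simp only [NNReal.coe_one, mul_one]
      linarith [Real.pi_gt_three]
    refine mul_le_one₀ (inv_le_one_of_one_le₀ h1) (Real.exp_pos _).le ?_
    rw [Real.exp_le_one_iff, neg_div]
    exact neg_nonpos.2 (by positivity)
  rw [gaussianReal_apply 0 one_ne_zero]
  calc ∫⁻ x in Metric.ball m r, gaussianPDF 0 1 x ≤ ∫⁻ _ in Metric.ball m r, 1 :=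
        lintegral_mono fun x => hpdf x
    _ = ENNReal.ofReal (2 * r) := by rw [setLIntegral_one, Real.volume_ball]

/-- Given `V₂`, this asks `V₃` to lie in an interval of length `2 * r`, and the normal density is at
most `1`. -/
lemma ratioBase_dist_lt_le (B : ℕ) (f : ℝ → ℝ) (hf : Measurable f) {r : ℝ} (hr : 0 ≤ r) :
    (ratioBase B).real {v | |v.2.2.1 - f v.2.1| < r} ≤ 2 * r := by
  have hm : MeasurableSet {z : ℝ × ℝ × ℝ | |z.2.1 - f z.1| < r} :=
    measurableSet_lt (by fun_prop) measurable_const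
  have h1 : ratioBase B {v | |v.2.2.1 - f v.2.1| < r} ≤ ENNReal.ofReal (2 * r) := by
    have e : {v : ℝ × ℝ × ℝ × ℝ | |v.2.2.1 - f v.2.1| < r}
        = Prod.snd ⁻¹' {z : ℝ × ℝ × ℝ | |z.2.1 - f z.1| < r} := rfl
    rw [e, ratioBase, measurePreserving_snd.measure_preimage hm.nullMeasurableSet,
      Measure.prod_apply hm]
    calc ∫⁻ x, ((gaussianReal 0 1).prod (chiSq (B - 1)))
          (Prod.mk x ⁻¹' {z : ℝ × ℝ × ℝ | |z.2.1 - f z.1| < r}) ∂(gaussianReal 0 1)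
        ≤ ∫⁻ _, ENNReal.ofReal (2 * r) ∂(gaussianReal 0 1) := by
          refine lintegral_mono fun x => ?_
          have e2 : Prod.mk x ⁻¹' {z : ℝ × ℝ × ℝ | |z.2.1 - f z.1| < r}
              = Prod.fst ⁻¹' (Metric.ball (f x) r) := by
            ext y; simp [Real.dist_eq]
          dsimp only
          rw [e2, measurePreserving_fst.measure_preimage measurableSet_ball.nullMeasurableSet]
          exact gaussianReal_ball_le _ _
      _ = ENNReal.ofReal (2 * r) := by simp
  exact ENNReal.toReal_le_of_le_ofReal (by positivity) h1

lemma exists_measureReal_gt_le {Ω : Type*} [MeasurableSpace Ω] (μ : Measure Ω)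
    [IsProbabilityMeasure μ] {f : Ω → ℝ} (hf : Measurable f) {ε : ℝ} (hε : 0 < ε) :
    ∃ M : ℝ, 0 < M ∧ μ.real {ω | M < f ω} ≤ ε := by
  have : IsProbabilityMeasure (μ.map f) := Measure.isProbabilityMeasure_map hf.aemeasurable
  have h := (tendsto_cdf_atTop (μ.map f)).eventually_const_lt (sub_lt_self 1 hε)
  obtain ⟨M, hM, hM0⟩ := (h.and (eventually_gt_atTop 0)).exists
  refine ⟨M, hM0, ?_⟩
  rw [cdf_eq_real, map_measureReal_apply hf measurableSet_Iic] at hM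
  have e : {ω | M < f ω} = (f ⁻¹' Set.Iic M)ᶜ := by ext; simp
  rw [e, probReal_compl_eq_one_sub (hf measurableSet_Iic)]
  linarith

/-- One `q` must serve all `θ`. With `c = √((θ² + ρ²)/B)`, the numerator is at most `(1 + θ) * M`
and the denominator at least `c * |V₃ - V₂/c|`, off events of total probability at most `α / 4 + 2 *
(α / 8) = α / 2`. Since `c ≥ c₀ * (1 + θ)`, the factor `1 + θ` cancels. -/
lemma criticalSet_nonempty {B : ℕ} (hB : 1 ≤ B) {ρ α : ℝ} (hρ : 0 < ρ) (hα : 0 < α) :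
    (criticalSet B ρ α).Nonempty := by
  obtain ⟨M, hM, hMle⟩ := exists_measureReal_gt_le (ratioBase B)
    (f := fun v => |v.1| + |v.2.1|) (by fun_prop) (ε := α / 4) (by positivity)
  have hB' : (0 : ℝ) < B := by exact_mod_cast hB
  set m := min 1 ρ with hm
  have hm0 : 0 < m := lt_min one_pos hρ
  -- From `θ² + ρ² ≥ m² (1 + θ²) ≥ m² (1 + θ)² / 2`.
  set c₀ := m / √(2 * B) with hc₀
  have hc₀0 : 0 < c₀ := by positivity
  -- Solves `q * (c₀ * (1 + θ) * (α / 8)) = (1 + θ) * M`.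
  set q := 8 * M / (c₀ * α) with hq
  have hq0 : 0 < q := by positivity
  refine ⟨q, mem_criticalSet_iff.2 fun θ => ?_⟩
  have hθ0 : (0 : ℝ) ≤ θ := θ.2
  set c := √(((θ : ℝ) ^ 2 + ρ ^ 2) / B) with hc
  have hc_ge : c₀ * (1 + θ) ≤ c := by
    refine Real.le_sqrt_of_sq_le ?_
    rw [mul_pow, hc₀, div_pow, Real.sq_sqrt (by positivity), le_div_iff₀ hB']
    have h1 : m ≤ 1 := min_le_left _ _
    have h2 : m ≤ ρ := min_le_right _ _
    have h3 : m ^ 2 ≤ 1 := pow_le_one₀ hm0.le h1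
    have h4 : m ^ 2 ≤ ρ ^ 2 := pow_le_pow_left₀ hm0.le h2 2
    have e : m ^ 2 / (2 * B) * (1 + (θ : ℝ)) ^ 2 * B = m ^ 2 * ((1 + (θ : ℝ)) ^ 2 / 2) := by
      field_simp
    rw [e]
    have h5 : (1 + (θ : ℝ)) ^ 2 / 2 ≤ 1 + (θ : ℝ) ^ 2 := by nlinarith [sq_nonneg (1 - (θ : ℝ))]
    nlinarith [sq_nonneg m, sq_nonneg (θ : ℝ), mul_le_mul_of_nonneg_left h5 (sq_nonneg m),
      mul_le_mul_of_nonneg_right h3 (sq_nonneg (θ : ℝ))]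
  have hc0 : 0 < c := lt_of_lt_of_le (by positivity) hc_ge
  have hae : ∀ᵐ v ∂(ratioBase B), v ∈ {v | q < ratio B θ ρ v} →
      v ∈ {v : ℝ × ℝ × ℝ × ℝ | M < |v.1| + |v.2.1|}
        ∪ {v | |v.2.2.1 - v.2.1 / c| < α / 8} := by
    filter_upwards [ae_ratioBase_nonneg B, ae_denSq_pos B θ ρ] with v hv0 hvpos hv
    by_contra! hcon
    simp only [Set.mem_union, Set.mem_ofPred_eq, not_or, not_lt] at hcon hv
    obtain ⟨hA, hC⟩ := hcon
    rw [ratio, lt_div_iff₀ (Real.sqrt_pos.2 hvpos)] at hv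
    have h1 : |c * v.2.2.1 - v.2.1| ≤ √(denSq B θ ρ v) := by
      rw [← Real.sqrt_sq_eq_abs]
      exact Real.sqrt_le_sqrt (sq_le_denSq B θ ρ hv0)
    have h2 : |c * v.2.2.1 - v.2.1| = c * |v.2.2.1 - v.2.1 / c| := by
      rw [← abs_of_pos hc0, ← abs_mul, abs_of_pos hc0]
      congr 1
      field_simp
    have h3 : (θ : ℝ) * v.1 + v.2.1 ≤ (1 + θ) * M := by
      have a1 := le_abs_self v.1
      have a2 := le_abs_self v.2.1
      have a3 := abs_nonneg v.1
      have a4 := abs_nonneg v.2.1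
      nlinarith [mul_le_mul_of_nonneg_left a1 hθ0, mul_nonneg hθ0 a4,
        mul_le_mul_of_nonneg_left hA hθ0]
    have h4 : c₀ * (1 + θ) * (α / 8) ≤ √(denSq B θ ρ v) := by
      refine le_trans ?_ h1
      rw [h2]
      exact mul_le_mul hc_ge hC (by positivity) hc0.le
    have h5 : q * (c₀ * (1 + θ) * (α / 8)) = (1 + θ) * M := by
      rw [hq]; field_simp
    have h6 := mul_le_mul_of_nonneg_left h4 hq0.le
    linarith
  have hle : (ratioBase B).real {v | q < ratio B θ ρ v} ≤ (ratioBase B).real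
      ({v : ℝ × ℝ × ℝ × ℝ | M < |v.1| + |v.2.1|} ∪ {v | |v.2.2.1 - v.2.1 / c| < α / 8}) :=
    ENNReal.toReal_mono (measure_ne_top _ _) (measure_mono_ae hae)
  have h1 := measureReal_union_le (μ := ratioBase B)
    {v : ℝ × ℝ × ℝ × ℝ | M < |v.1| + |v.2.1|} {v | |v.2.2.1 - v.2.1 / c| < α / 8}
  have h2 := ratioBase_dist_lt_le B (fun x => x / c) (by fun_prop) (r := α / 8) (by positivity)
  rw [measure_ratio_gt] at hle
  linarith

/-- A lower bound comes from the single value `θ = 0`, whose distribution function tends to `0 < 1 -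
α / 2` at `-∞`. Membership of the infimum is checked for each `θ` separately, by right-continuity.
-/
theorem isLeast_criticalSet {B : ℕ} (hB : 1 ≤ B) {ρ α : ℝ} (hρ : 0 < ρ) (hα : 0 < α)
    (hα' : α < 1) : IsLeast (criticalSet B ρ α) (qO B ρ α) := by
  have hne := criticalSet_nonempty hB hρ hα
  have hbdd : BddBelow (criticalSet B ρ α) := by
    have h := (tendsto_cdf_atBot (ratioLaw B ((0 : ℝ≥0) : ℝ) ρ)).eventually_lt_const
      (show (0 : ℝ) < 1 - α / 2 by linarith)
    obtain ⟨q₀, hq₀⟩ := h.exists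
    refine ⟨q₀, fun q hq => ?_⟩
    by_contra! hlt
    have h1 := mem_criticalSet_iff.1 hq 0
    have h2 : F B q ((0 : ℝ≥0) : ℝ) ρ ≤ cdf (ratioLaw B ((0 : ℝ≥0) : ℝ) ρ) q₀ :=
      monotone_cdf _ hlt.le
    linarith
  refine ⟨mem_criticalSet_iff.2 fun θ => ?_, fun q hq => csInf_le hbdd hq⟩
  have hcont : Tendsto (fun q => cdf (ratioLaw B θ ρ) q) (𝓝[>] (qO B ρ α))
      (𝓝 (cdf (ratioLaw B θ ρ) (qO B ρ α))) :=
    ((cdf (ratioLaw B θ ρ)).right_continuous _).mono_left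
      (nhdsWithin_mono _ Set.Ioi_subset_Ici_self)
  refine ge_of_tendsto hcont ?_
  filter_upwards [self_mem_nhdsWithin] with q hq
  obtain ⟨q', hq', hlt⟩ := exists_lt_of_csInf_lt hne hq
  exact (mem_criticalSet_iff.1 hq' θ).trans (monotone_cdf _ hlt.le)

end CheapBootstrap

namespace CheapBootstrap

/-! ### Sums and sums of squares of normal variables -/

/-- The sum and the sum of squares of `m + 1` standard normal variables have the joint law of
`√(m + 1) V` and `Y + V²`, where `V ∼ N(0,1)` and `Y ∼ χ²_m` are independent. -/
lemma map_sum_sumSq (m : ℕ) :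
    (Measure.pi fun _ : Fin (m + 1) => gaussianReal 0 1).map (fun u => (∑ i, u i, ∑ i, u i ^ 2))
      = ((gaussianReal 0 1).prod (chiSq m)).map
        fun z => (√((m + 1 : ℕ) : ℝ) * z.1, z.2 + z.1 ^ 2) := by
  have hN : (0 : ℝ) < ((m + 1 : ℕ) : ℝ) := by positivity
  -- The normalized diagonal. In an orthonormal basis that starts with `e`, the coordinates are
  -- again standard normal, the first is the sum divided by `√(m + 1)`, and the norm is unchanged.
  set e : EuclideanSpace ℝ (Fin (m + 1)) := WithLp.toLp 2 fun _ => (√((m + 1 : ℕ) : ℝ))⁻¹ with he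
  have he1 : ‖e‖ = 1 := by
    rw [← sq_eq_sq₀ (norm_nonneg _) zero_le_one, EuclideanSpace.real_norm_sq_eq]
    simp only [he, Finset.sum_const, Finset.card_univ, Fintype.card_fin, nsmul_eq_mul, inv_pow,
      Real.sq_sqrt hN.le]
    rw [one_pow, mul_inv_cancel₀ hN.ne']
  obtain ⟨b, hb⟩ := Orthonormal.exists_orthonormalBasis_extension_of_card_eq (𝕜 := ℝ)
    (E := EuclideanSpace ℝ (Fin (m + 1)))
    (ι := Fin (m + 1)) (by simp) (v := fun _ => e) (s := {0}) (by
      rw [orthonormal_iff_ite]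
      rintro ⟨i, hi⟩ ⟨j, hj⟩
      obtain rfl : i = 0 := hi
      obtain rfl : j = 0 := hj
      simp [he1])
  have hb0 : b 0 = e := hb 0 rfl
  set G : EuclideanSpace ℝ (Fin (m + 1)) → ℝ × ℝ := fun v => (∑ i, v i, ‖v‖ ^ 2) with hG
  have hGm : Measurable G := by
    refine Measurable.prodMk ?_ (by fun_prop)
    refine Finset.measurable_fun_sum _ fun i _ => ?_
    exact (EuclideanSpace.proj (𝕜 := ℝ) i).continuous.measurable
  have h1 : (Measure.pi fun _ : Fin (m + 1) => gaussianReal 0 1).map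
      (fun u => (∑ i, u i, ∑ i, u i ^ 2))
      = (Measure.pi fun _ : Fin (m + 1) => gaussianReal 0 1).map
        (fun u => (√((m + 1 : ℕ) : ℝ) * u 0, ∑ i, u i ^ 2)) := by
    have e1 : (fun u : Fin (m + 1) → ℝ => (∑ i, u i, ∑ i, u i ^ 2)) = G ∘ (WithLp.toLp 2) := by
      ext u <;> simp [hG, EuclideanSpace.real_norm_sq_eq]
    have e2 : (fun u : Fin (m + 1) → ℝ => (√((m + 1 : ℕ) : ℝ) * u 0, ∑ i, u i ^ 2))
        = G ∘ (fun x => ∑ i, x i • b i) := by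
      funext u
      have hn : ‖∑ i, u i • b i‖ ^ 2 = ∑ i, u i ^ 2 := by
        rw [← real_inner_self_eq_norm_sq, b.orthonormal.inner_sum]
        simp [sq]
      have hs : ∑ i, (∑ j, u j • b j : EuclideanSpace ℝ (Fin (m + 1))) i = √((m + 1 : ℕ) : ℝ) * u 0 := by
        have hin : inner ℝ (b 0) (∑ j, u j • b j) = u 0 :=
          b.orthonormal.inner_right_fintype u 0
        rw [hb0, PiLp.inner_apply] at hin
        rw [← hin, Finset.mul_sum]
        refine Finset.sum_congr rfl fun i _ => ?_
        simp only [he, RCLike.inner_apply, conj_trivial]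
        field_simp
      simp only [Function.comp_apply, hG, hn, hs]
    rw [e1, e2, ← Measure.map_map hGm (by fun_prop), ← Measure.map_map hGm (by fun_prop),
      map_pi_eq_stdGaussian, ← stdGaussian_eq_map_pi_orthonormalBasis]
  rw [h1]
  have h2 := measurePreserving_piFinSuccAbove (fun _ : Fin (m + 1) => gaussianReal 0 1) 0
  have e3 : (fun u : Fin (m + 1) → ℝ => (√((m + 1 : ℕ) : ℝ) * u 0, ∑ i, u i ^ 2))
      = (fun z : ℝ × (Fin m → ℝ) => (√((m + 1 : ℕ) : ℝ) * z.1, (∑ i, z.2 i ^ 2) + z.1 ^ 2))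
        ∘ (MeasurableEquiv.piFinSuccAbove (fun _ => ℝ) 0) := by
    funext u
    simp [MeasurableEquiv.piFinSuccAbove, Fin.sum_univ_succ, add_comm, Fin.tail]
  rw [e3, ← Measure.map_map (by fun_prop) (MeasurableEquiv.measurable _), h2.map_eq]
  have e4 : (gaussianReal 0 1).prod (chiSq m)
      = ((gaussianReal 0 1).prod (Measure.pi fun _ : Fin m => gaussianReal 0 1)).map
        (Prod.map id fun z => ∑ i, z i ^ 2) := by
    rw [← Measure.map_prod_map _ _ measurable_id (by fun_prop), Measure.map_id, chiSq]
  rw [e4, Measure.map_map (by fun_prop) (by fun_prop)]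
  rfl

/-- The limiting coverage event has the same probability in terms of `U₁, …, U_B` as in terms of
`V₃` and `Y`. -/
lemma normalLaw_event_eq {B : ℕ} (hB : 1 ≤ B) (θ ρ q : ℝ) :
    normalLaw B {z | |θ * z.1 + z.2.1|
        < q * √((∑ b, (√(θ ^ 2 + ρ ^ 2) * z.2.2 b - z.2.1) ^ 2) / B)}
      = ratioBase B {v | |θ * v.1 + v.2.1| < q * √(denSq B θ ρ v)} := by
  obtain ⟨m, rfl⟩ : ∃ m, B = m + 1 := ⟨B - 1, by omega⟩
  have hN : (0 : ℝ) < ((m + 1 : ℕ) : ℝ) := by positivity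
  set k := √(θ ^ 2 + ρ ^ 2) with hk
  have hk2 : k ^ 2 = θ ^ 2 + ρ ^ 2 := Real.sq_sqrt (by positivity)
  -- Expanding the squares shows that the event sees the `U_b` only through their sum and sum of
  -- squares; `T` is the event in these variables.
  set T : Set (ℝ × ℝ × ℝ × ℝ) := {w | |θ * w.1 + w.2.1| < q * √((k ^ 2 * w.2.2.2
    - 2 * k * w.2.1 * w.2.2.1) / ((m + 1 : ℕ) : ℝ) + w.2.1 ^ 2)} with hT
  have hTm : MeasurableSet T := measurableSet_lt (by fun_prop) (by fun_prop)
  have hf : Measurable fun u : Fin (m + 1) → ℝ => (∑ i, u i, ∑ i, u i ^ 2) := by fun_prop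
  have hlaw : (normalLaw (m + 1)).map
        (Prod.map id (Prod.map id fun u => (∑ i, u i, ∑ i, u i ^ 2)))
      = (ratioBase (m + 1)).map (Prod.map id (Prod.map id
        fun z => (√((m + 1 : ℕ) : ℝ) * z.1, z.2 + z.1 ^ 2))) := by
    have hf1 : IsProbabilityMeasure ((Measure.pi fun _ : Fin (m + 1) => gaussianReal 0 1).map
      fun u => (∑ i, u i, ∑ i, u i ^ 2)) := Measure.isProbabilityMeasure_map hf.aemeasurable
    rw [normalLaw, ratioBase, ← Measure.map_prod_map _ _ measurable_id (by fun_prop),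
      ← Measure.map_prod_map _ _ measurable_id (by fun_prop),
      ← Measure.map_prod_map _ _ measurable_id (by fun_prop),
      ← Measure.map_prod_map _ _ measurable_id (by fun_prop), map_sum_sumSq]
    rfl
  have h := congrArg (fun μ : Measure (ℝ × ℝ × ℝ × ℝ) => μ T) hlaw
  rw [Measure.map_apply (by fun_prop) hTm, Measure.map_apply (by fun_prop) hTm] at h
  convert h using 2
  · ext z
    simp only [hT, Set.mem_preimage, Set.mem_ofPred_eq]
    have : (∑ b, (k * z.2.2 b - z.2.1) ^ 2) / ((m + 1 : ℕ) : ℝ)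
        = (k ^ 2 * ∑ i, z.2.2 i ^ 2 - 2 * k * z.2.1 * ∑ i, z.2.2 i) / ((m + 1 : ℕ) : ℝ)
          + z.2.1 ^ 2 := by
      have e : ∑ b, (k * z.2.2 b - z.2.1) ^ 2 = k ^ 2 * ∑ i, z.2.2 i ^ 2
          - 2 * k * z.2.1 * ∑ i, z.2.2 i + ((m + 1 : ℕ) : ℝ) * z.2.1 ^ 2 := by
        simp only [sub_sq, mul_pow, Finset.sum_add_distrib, Finset.sum_sub_distrib,
          Finset.mul_sum, Finset.sum_const, Finset.card_univ, Fintype.card_fin, nsmul_eq_mul]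
        congr 2
        exact Finset.sum_congr rfl fun i _ => by ring
      rw [e]
      field_simp
    rw [this]
    rfl
  · ext v
    simp only [hT, Set.mem_preimage, Set.mem_ofPred_eq]
    have : denSq (m + 1) θ ρ v = (k ^ 2 * (v.2.2.2 + v.2.2.1 ^ 2)
        - 2 * k * v.2.1 * (√((m + 1 : ℕ) : ℝ) * v.2.2.1)) / ((m + 1 : ℕ) : ℝ) + v.2.1 ^ 2 := by
      have hr : √((m + 1 : ℕ) : ℝ) ^ 2 = ((m + 1 : ℕ) : ℝ) := Real.sq_sqrt hN.le
      have hr0 : √((m + 1 : ℕ) : ℝ) ≠ 0 := (Real.sqrt_pos.2 hN).ne'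
      rw [denSq, Real.sqrt_div (by positivity), ← hk, hk2]
      have : k / √((m + 1 : ℕ) : ℝ) = k * √((m + 1 : ℕ) : ℝ) / ((m + 1 : ℕ) : ℝ) := by
        rw [div_eq_div_iff hr0 hN.ne', mul_assoc, ← sq, hr]
      rw [this]
      ring
    rw [this]
    rfl

/-! ### Coverage -/

/-- The set of error vectors for which the interval with critical value `q` has the target in its
interior. -/
def coverSet (B : ℕ) (q : ℝ) : Set (EuclideanSpace ℝ (Option (Option (Fin B)))) :=
  {v | |v none + v (some none)| < q * √((∑ b, (v (some (some b)) - v (some none)) ^ 2) / B)}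

lemma isOpen_coverSet (B : ℕ) (q : ℝ) : IsOpen (coverSet B q) :=
  isOpen_lt (by fun_prop) (by fun_prop)

/-- The centring at the functional of the empirical distribution cancels in both sides of the
inequality, and the factor `√n` divides out. -/
lemma mem_intervalO_of_errVec_mem {𝒳 𝒰 : Type*} [MeasurableSpace 𝒳]
    {ψ : ProbabilityMeasure 𝒳 → ℝ} {run : ProbabilityMeasure 𝒳 → 𝒰 → ℝ} {P : ProbabilityMeasure 𝒳}
    {n : ℕ+} {B R₀ R : ℕ} {q : ℝ} {ω : Outcome 𝒳 𝒰 n B R₀ R}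
    (h : errVec ψ run P ω ∈ coverSet B q) : ψ P ∈ intervalO run q ω := by
  have hn : (0 : ℝ) < √(n : ℝ) := Real.sqrt_pos.2 (by exact_mod_cast n.pos)
  have e1 : (errVec ψ run P ω) none + (errVec ψ run P ω) (some none)
      = √(n : ℝ) * (pointEst run ω - ψ P) := by
    simp only [errVec, Option.elim]; ring
  have e2 : √((∑ b, ((errVec ψ run P ω) (some (some b)) - (errVec ψ run P ω) (some none)) ^ 2) / B)
      = √(n : ℝ) * SO run ω := by
    have : ∀ b, ((errVec ψ run P ω) (some (some b)) - (errVec ψ run P ω) (some none)) ^ 2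
        = √(n : ℝ) ^ 2 * (resampleEst run ω b - pointEst run ω) ^ 2 := fun b => by
      simp only [errVec, Option.elim]; ring
    rw [Finset.sum_congr rfl fun b _ => this b, ← Finset.mul_sum, mul_div_assoc,
      Real.sqrt_mul (by positivity), Real.sqrt_sq hn.le, SO]
  simp only [coverSet, Set.mem_ofPred_eq] at h
  rw [e1, e2, abs_mul, abs_of_pos hn, mul_left_comm, mul_lt_mul_iff_right₀ hn, abs_lt] at h
  exact ⟨by linarith [h.2], by linarith [h.1]⟩

/-- Dividing by `s` leaves only the ratio `θ = c / s` and `ρ`, and the critical value is valid for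
every `θ`. -/
lemma le_normalLaw_coverSet {B : ℕ} (hB : 1 ≤ B) {α q c s ρ : ℝ} (hc : 0 < c) (hs : 0 < s)
    (hq : q ∈ criticalSet B ρ α) :
    ENNReal.ofReal (1 - α)
      ≤ normalLaw B (scaleVec B c s √(c ^ 2 + ρ ^ 2 * s ^ 2) ⁻¹' coverSet B q) := by
  set θ : ℝ≥0 := ⟨c / s, by positivity⟩ with hθ
  have hθ' : (θ : ℝ) = c / s := rfl
  have hθ0 : θ ≠ 0 := by
    rw [← NNReal.coe_ne_zero, hθ']; positivity
  have hset : scaleVec B c s √(c ^ 2 + ρ ^ 2 * s ^ 2) ⁻¹' coverSet B q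
      = {z | |(θ : ℝ) * z.1 + z.2.1|
        < q * √((∑ b, (√((θ : ℝ) ^ 2 + ρ ^ 2) * z.2.2 b - z.2.1) ^ 2) / B)} := by
    ext z
    have e0 : √(c ^ 2 + ρ ^ 2 * s ^ 2) = s * √((θ : ℝ) ^ 2 + ρ ^ 2) := by
      have : c ^ 2 + ρ ^ 2 * s ^ 2 = s ^ 2 * ((θ : ℝ) ^ 2 + ρ ^ 2) := by
        rw [hθ']; field_simp
      rw [this, Real.sqrt_mul (by positivity), Real.sqrt_sq hs.le]
    have e1 : c * z.1 + s * z.2.1 = s * ((θ : ℝ) * z.1 + z.2.1) := by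
      rw [hθ']; field_simp
    have e2 : √((∑ b, (s * √((θ : ℝ) ^ 2 + ρ ^ 2) * z.2.2 b - s * z.2.1) ^ 2) / B)
        = s * √((∑ b, (√((θ : ℝ) ^ 2 + ρ ^ 2) * z.2.2 b - z.2.1) ^ 2) / B) := by
      have : ∀ b, (s * √((θ : ℝ) ^ 2 + ρ ^ 2) * z.2.2 b - s * z.2.1) ^ 2
          = s ^ 2 * (√((θ : ℝ) ^ 2 + ρ ^ 2) * z.2.2 b - z.2.1) ^ 2 := fun b => by ring
      rw [Finset.sum_congr rfl fun b _ => this b, ← Finset.mul_sum, mul_div_assoc,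
        Real.sqrt_mul (by positivity), Real.sqrt_sq hs.le]
    simp only [Set.mem_preimage, coverSet, Set.mem_ofPred_eq, scaleVec, Option.elim, e0, e1, e2,
      abs_mul, abs_of_pos hs]
    rw [mul_left_comm, mul_lt_mul_iff_right₀ hs]
  rw [hset, normalLaw_event_eq hB]
  exact ENNReal.ofReal_le_of_le_toReal (le_ratioBase_abs_num_lt hq hθ0)

end CheapBootstrap

open CheapBootstrap in
theorem theorem4 {𝒳 𝒰 : Type*} [MeasurableSpace 𝒳] [MeasurableSpace 𝒰]
    (P : ProbabilityMeasure 𝒳) (ψ : ProbabilityMeasure 𝒳 → ℝ)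
    (run : ProbabilityMeasure 𝒳 → 𝒰 → ℝ) (η : Measure 𝒰) [IsProbabilityMeasure η]
    (hmeas : ∀ n : ℕ+, Measurable fun z : (Fin n → 𝒳) × 𝒰 => run (empirical z.1) z.2)
    (hunbiased : ∀ Q, Integrable (run Q) η ∧ ∫ u, run Q u ∂η = ψ Q)
    (σ : ℝ≥0) (hboot : BootstrapValidity ψ P σ) (hmom : MomentConsistency ψ run η P)
    (R₀ R : ℕ+ → ℕ) (p₀ p : ℝ) (hp₀ : 0 < p₀) (hp₀' : p₀ < 1) (hp : 0 < p) (hp' : p < 1)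
    (hR₀ : Tendsto (fun n : ℕ+ => (R₀ n : ℝ) / n) atTop (𝓝 p₀))
    (hR : Tendsto (fun n : ℕ+ => (R n : ℝ) / n) atTop (𝓝 p))
    (B : ℕ) (hB : 1 ≤ B) (α : ℝ) (hα : 0 < α) (hα' : α < 1) :
    IsLeast (criticalSet B (√(p₀ / p)) α) (qO B (√(p₀ / p)) α) ∧
    ENNReal.ofReal (1 - α) ≤ liminf (fun n : ℕ+ =>
      outcomeLaw P η n B (R₀ n) (R n)
        {ω | ψ P ∈ intervalO run (qO B (√(p₀ / p)) α) ω}) atTop := by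
  have hleast := isLeast_criticalSet hB (ρ := √(p₀ / p)) (Real.sqrt_pos.2 (by positivity)) hα hα'
  refine ⟨hleast, ?_⟩
  set q := qO B (√(p₀ / p)) α with hq
  have hv : 0 < (runVar run η P).toReal := ENNReal.toReal_pos hmom.var_pos.ne' hmom.var_lt_top.ne
  have hweak := tendsto_law_errVec hmeas hunbiased hboot hmom hp₀ hp hR₀ hR B
  have hport := ProbabilityMeasure.le_liminf_measure_open_of_tendsto hweak (isOpen_coverSet B q)
  have hcov := le_normalLaw_coverSet hB (q := q) (α := α) (c := (σ : ℝ))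
    (s := √((runVar run η P).toReal / p₀)) (ρ := √(p₀ / p))
    (by exact_mod_cast hboot.pos) (Real.sqrt_pos.2 (by positivity)) hleast.1
  -- The choice of `ρ` makes `ρ² s² = τ²/p`, so `√(c² + ρ² s²)` is the limiting standard deviation
  -- of a resample error.
  have hk : (√(p₀ / p)) ^ 2 * √((runVar run η P).toReal / p₀) ^ 2
      = (runVar run η P).toReal / p := by
    rw [Real.sq_sqrt (by positivity), Real.sq_sqrt (by positivity)]
    field_simp
  rw [hk, ← Measure.map_apply (measurable_scaleVec _ _ _ _) (isOpen_coverSet B q).measurableSet]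
    at hcov
  refine hcov.trans (hport.trans (liminf_le_liminf (Eventually.of_forall fun n => ?_)))
  rw [ProbabilityMeasure.coe_mk,
    Measure.map_apply (measurable_errVec hmeas hunbiased) (isOpen_coverSet B q).measurableSet]
  exact measure_mono fun ω hω => mem_intervalO_of_errVec_mem hω
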